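/- Let $f:\mathbb R^n\to\mathbb R$, $g:\mathbb R^n\to\mathbb R\cup\{+\infty\}$, $h:\mathbb R^r\to\mathbb R\cup\{+\infty\}$ and $L\in\mathbb R^{r\times n}$. For a symmetric positive definite matrix $V$ write $\|x\|_V=\sqrt{\langle x,Vx\rangle}$ and $\operatorname{prox}_\varphi^V(x)=\operatorname{argmin}_y\{\varphi(y)+\tfrac12\|x-y\|_V^2\}$, and let $\varphi^*(v)=\sup_x\{\langle v,x\rangle-\varphi(x)\}$ be the Fenchel conjugate. Assume: 1. $g$ and $h$ are proper, closed (lower semicontinuous) and convex; 2. $f$ is convex and continuously differentiable, and there are a symmetric positive definite $Q\in\mathbb R^{n\times n}$ and $\beta_f\in[0,\infty)$ with $\|\nabla f(x)-\nabla f(y)\|_{Q^{-1}}\le\beta_f\|x-y\|_Q$ for all $x,y\in\mathbb R^n$; 3. the problem $\min_{x\in\mathbb R^n} f(x)+g(x)+h(Lx)$ (the primal problem) has a solution, and there is $x\in\operatorname{ri}\operatorname{dom}g$ with $Lx\in\operatorname{ri}\operatorname{dom}h$; 4. $\Sigma\in\mathbb R^{r\times r}$ and $\Gamma\in\mathbb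 R^{n\times n}$ are symmetric positive definite and $\Gamma^{-1}-\tfrac{\beta_f}{2}Q-L^\top\Sigma L\succ0$. Let $\mathcal S$ be the set of primal-dual solutions, i.e. of the pairs $(u^\star,x^\star)\in\mathbb R^r\times\mathbb R^n$ such that $u^\star$ solves the dual problem $\min_{u\in\mathbb R^r}(g+f)^*(-L^\top u)+h^*(u)$ and $x^\star$ solves the primal problem. Put $$S=\begin{pmatrix}\Sigma^{-1}&0\\0&\Gamma^{-1}\end{pmatrix},\qquad \tilde P=\begin{pmatrix}\Sigma^{-1}&-\tfrac12L\\-\tfrac12L^\top&\Gamma^{-1}-\tfrac{\beta_f}{4}Q\end{pmatrix}.$$ Given any starting point $(u^0,x^0)\in\mathbb R^r\times\mathbb R^n$, let $z^k=(u^k,x^k)$ be generated by the TriPD iteration $$\bar u^k=\operatorname{prox}_{h^*}^{\Sigma^{-1}}(u^k+\Sigma Lx^k),\quad x^{k+1}=\operatorname{prox}_g^{\Gamma^{-1}}\bigl(x^k-\Gamma\nabla f(x^k)-\Gamma L^\top\bar u^k\bigr),\quad u^{k+1}=\bar u^k+\Sigma L(x^{k+1}-x^k),\qquad k=0,1,2,\dots$$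 Then $S$ and $2\tilde P-S$ are symmetric positive definite, and for every $z^\star\in\mathcal S$ and every $k\ge0$ $$\|z^{k+1}-z^\star\|_S^2\le\|z^k-z^\star\|_S^2-\|z^{k+1}-z^k\|_{2\tilde P-S}^2 .$$ Moreover, $(z^k)_{k\ge0}$ converges to some $z^\star\in\mathcal S$. -/

import Mathlib

open Filter Topology

namespace TriPD

noncomputable section

/-- The Euclidean space `ℝⁿ`. -/
abbrev E (n : ℕ) : Type := EuclideanSpace ℝ (Fin n)

/-- The linear map `ℝⁿ → ℝᵐ` given by an `m × n` matrix. -/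
def act {m n : ℕ} (A : Matrix (Fin m) (Fin n) ℝ) (x : E n) : E m :=
  WithLp.toLp 2 (A.mulVec x.ofLp)

/-- The norm `‖x‖_V = √⟨x, V x⟩` (used for symmetric positive definite `V`). -/
def wnorm {n : ℕ} (V : Matrix (Fin n) (Fin n) ℝ) (x : E n) : ℝ :=
  √(inner ℝ x (act V x))

/-- The vector of `ℝ^{r+n}` with the blocks `u` and `x`, for a pair `z = (u, x)`. -/
def stack {r n : ℕ} (z : E r × E n) : EuclideanSpace ℝ (Fin r ⊕ Fin n) :=
  WithLp.toLp 2 (Sum.elim z.1.ofLp z.2.ofLp)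

/-- The norm `‖z‖_W = √⟨z, W z⟩` of a pair `z = (u, x)`, for a `2 × 2` block matrix `W`. -/
def blockNorm {r n : ℕ} (W : Matrix (Fin r ⊕ Fin n) (Fin r ⊕ Fin n) ℝ) (z : E r × E n) : ℝ :=
  √(inner ℝ (stack z) (WithLp.toLp 2 (W.mulVec (stack z).ofLp)))

/-- The (effective) domain of an extended-real-valued function. -/
def dom {n : ℕ} (φ : E n → EReal) : Set (E n) := {x | φ x < ⊤}

/-- Proper, closed (i.e. lower semicontinuous), convex functions `ℝⁿ → ℝ ∪ {+∞}`. -/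
structure ProperClosedConvex {n : ℕ} (φ : E n → EReal) : Prop where
  ne_bot : ∀ x, φ x ≠ ⊥
  dom_nonempty : (dom φ).Nonempty
  closed : LowerSemicontinuous φ
  convex : Convex ℝ {p : E n × ℝ | φ p.1 ≤ (p.2 : EReal)}

/-- The minimizers of an extended-real-valued function (none if it is identically `+∞`). -/
def argmin {n : ℕ} (φ : E n → EReal) : Set (E n) :=
  {x | x ∈ dom φ ∧ ∀ y, φ x ≤ φ y}

/-- The Fenchel conjugate `φ*(v) = sup_x (⟨v, x⟩ - φ(x))`. -/
def conj {n : ℕ} (φ : E n → EReal) (v : E n) : EReal :=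
  ⨆ x : E n, ((inner ℝ v x : ℝ) : EReal) - φ x

/-- The proximal mapping `prox_φ^V(x) = argmin_y { φ(y) + ½ ‖x - y‖_V² }`. The minimizer exists
and is unique for `φ` proper, closed and convex and `V` symmetric positive definite. -/
def prox {n : ℕ} (V : Matrix (Fin n) (Fin n) ℝ) (φ : E n → EReal) (x : E n) : E n :=
  Classical.epsilon fun p =>
    p ∈ argmin fun y => φ y + ((1 / 2 * wnorm V (x - y) ^ 2 : ℝ) : EReal)

/-- The primal objective `f(x) + g(x) + h(Lx)`. -/
def primalObj {r n : ℕ} (f : E n → ℝ) (g : E n → EReal) (h : E r → EReal)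
    (L : Matrix (Fin r) (Fin n) ℝ) (x : E n) : EReal :=
  (f x : EReal) + g x + h (act L x)

/-- The objective `(g + f)*(-Lᵀu) + h*(u)` of the dual minimization problem. -/
def dualObj {r n : ℕ} (f : E n → ℝ) (g : E n → EReal) (h : E r → EReal)
    (L : Matrix (Fin r) (Fin n) ℝ) (u : E r) : EReal :=
  conj (fun x => g x + (f x : EReal)) (-(act L.transpose u)) + conj h u

/-- The set of primal-dual solutions `(u, x)`: `u` solves the dual and `x` the primal problem. -/
def solutions {r n : ℕ} (f : E n → ℝ) (g : E n → EReal) (h : E r → EReal)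
    (L : Matrix (Fin r) (Fin n) ℝ) : Set (E r × E n) :=
  {z | z.1 ∈ argmin (dualObj f g h L) ∧ z.2 ∈ argmin (primalObj f g h L)}

/-- One iteration `(u, x) ↦ (u⁺, x⁺)` of TriPD, with dual and primal stepsize matrices
`Sig` and `Gam`:
`ū = prox_{h*}^{Sig⁻¹}(u + Sig L x)`, `x⁺ = prox_g^{Gam⁻¹}(x - Gam ∇f(x) - Gam Lᵀ ū)`,
`u⁺ = ū + Sig L (x⁺ - x)`. -/
def step {r n : ℕ} (f : E n → ℝ) (g : E n → EReal) (h : E r → EReal)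
    (L : Matrix (Fin r) (Fin n) ℝ) (Sig : Matrix (Fin r) (Fin r) ℝ)
    (Gam : Matrix (Fin n) (Fin n) ℝ) (z : E r × E n) : E r × E n :=
  let ubar : E r := prox Sig⁻¹ (conj h) (z.1 + act Sig (act L z.2))
  let xnew : E n :=
    prox Gam⁻¹ g (z.2 - act Gam (gradient f z.2) - act Gam (act L.transpose ubar))
  (ubar + act Sig (act L (xnew - z.2)), xnew)

/-- `S = blkdiag(Sig⁻¹, Gam⁻¹)`. -/
def matS {r n : ℕ} (Sig : Matrix (Fin r) (Fin r) ℝ) (Gam : Matrix (Fin n) (Fin n) ℝ) :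
    Matrix (Fin r ⊕ Fin n) (Fin r ⊕ Fin n) ℝ :=
  Matrix.fromBlocks Sig⁻¹ 0 0 Gam⁻¹

/-- `P̃ = [[Sig⁻¹, -½ L], [-½ Lᵀ, Gam⁻¹ - (β/4) Q]]`. -/
def matPtilde {r n : ℕ} (L : Matrix (Fin r) (Fin n) ℝ) (Sig : Matrix (Fin r) (Fin r) ℝ)
    (Gam Q : Matrix (Fin n) (Fin n) ℝ) (β : ℝ) :
    Matrix (Fin r ⊕ Fin n) (Fin r ⊕ Fin n) ℝ :=
  Matrix.fromBlocks Sig⁻¹ (-((1 / 2 : ℝ) • L)) (-((1 / 2 : ℝ) • L.transpose))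
    (Gam⁻¹ - (β / 4) • Q)

end

end TriPD

/-! Primal-dual solutions are exactly the KKT points: -∇f(x) - Lᵀu ∈ ∂g(x) and u ∈ ∂h(Lx)
(`isKKT_iff_mem_solutions`). KKT points are optimal by equality in Fenchel-Young; the converse needs
a multiplier, which the relative interior condition provides by extending a functional positive on a
cone (`exists_multiplier`).

The two prox steps put explicit vectors into ∂h*(ū) and ∂g(x⁺) (`step_spec`); the correction u⁺ = ū
+ ΣL(x⁺ - x) turns the first one into Lx⁺ - Σ⁻¹(u⁺ - u). Monotonicity against a KKT point z* gives
two inequalities in whose sum the coupling term ⟨ū - u*, L(x⁺ - x*)⟩ cancels. The gradient term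
costs at most (β/4)‖x⁺ - x‖_Q² (`inner_gradient_sub_le`). What is left, ⟨z⁺ - z, S(z⁺ - z*)⟩ ≤ ⟨u⁺ -
u, L(x⁺ - x)⟩ + (β/4)‖x⁺ - x‖_Q², becomes the Fejér inequality once the squares are expanded
(`IsKKT.blockNorm_step_le`). The matrix 2P̃ - S is positive definite because its Schur complement is
the stepsize matrix.

Convergence is Opial's argument: the S-distance to each KKT point converges and the steps tend to
zero, so a cluster point is KKT by closedness of subdifferential graphs, and the distance to that
point must tend to zero. -/

namespace TriPD

/-! ### Matrices acting on Euclidean space and weighted norms -/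

section LinearAlgebra

variable {l m n : ℕ}

theorem act_add (A : Matrix (Fin m) (Fin n) ℝ) (x y : E n) : act A (x + y) = act A x + act A y := by
  ext i; simp [act, Matrix.mulVec_add]

theorem act_sub (A : Matrix (Fin m) (Fin n) ℝ) (x y : E n) : act A (x - y) = act A x - act A y := by
  ext i; simp [act, Matrix.mulVec_sub]

theorem act_neg (A : Matrix (Fin m) (Fin n) ℝ) (x : E n) : act A (-x) = -act A x := by
  ext i; simp [act, Matrix.mulVec_neg]

theorem act_smul (A : Matrix (Fin m) (Fin n) ℝ) (c : ℝ) (x : E n) :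
    act A (c • x) = c • act A x := by
  ext i; simp [act, Matrix.mulVec_smul]

theorem act_act (A : Matrix (Fin l) (Fin m) ℝ) (B : Matrix (Fin m) (Fin n) ℝ) (x : E n) :
    act A (act B x) = act (A * B) x := by
  ext i; simp [act, Matrix.mulVec_mulVec]

theorem act_one (x : E n) : act 1 x = x := by
  ext i; simp [act]

theorem sub_act (A B : Matrix (Fin m) (Fin n) ℝ) (x : E n) : act (A - B) x = act A x - act B x := by
  ext i; simp [act, Matrix.sub_mulVec]

theorem smul_act (c : ℝ) (A : Matrix (Fin m) (Fin n) ℝ) (x : E n) :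
    act (c • A) x = c • act A x := by
  ext i; simp [act, Matrix.smul_mulVec]

theorem continuous_act (A : Matrix (Fin m) (Fin n) ℝ) : Continuous (act A) := by
  unfold act; fun_prop

theorem inner_eq_dotProduct {ι : Type*} [Fintype ι] (x y : EuclideanSpace ℝ ι) :
    inner ℝ x y = x.ofLp ⬝ᵥ y.ofLp := by
  simp [PiLp.inner_apply, dotProduct, mul_comm]

theorem inner_act_left (A : Matrix (Fin m) (Fin n) ℝ) (x : E n) (y : E m) :
    inner ℝ (act A x) y = inner ℝ x (act A.transpose y) := by
  simp only [inner_eq_dotProduct, act]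
  rw [Matrix.mulVec_transpose, dotProduct_comm, Matrix.dotProduct_mulVec, dotProduct_comm]

theorem inner_act_right (A : Matrix (Fin m) (Fin n) ℝ) (x : E n) (y : E m) :
    inner ℝ y (act A x) = inner ℝ (act A.transpose y) x := by
  rw [real_inner_comm, inner_act_left, real_inner_comm]

theorem transpose_eq_of_posDef {V : Matrix (Fin n) (Fin n) ℝ} (hV : V.PosDef) :
    V.transpose = V := by
  simpa [Matrix.IsHermitian, Matrix.conjTranspose_eq_transpose_of_trivial] using hV.1

theorem inner_act_comm {V : Matrix (Fin n) (Fin n) ℝ} (hV : V.PosDef) (x y : E n) :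
    inner ℝ x (act V y) = inner ℝ y (act V x) := by
  rw [inner_act_right, transpose_eq_of_posDef hV, real_inner_comm]

theorem act_inv_act {V : Matrix (Fin n) (Fin n) ℝ} (hV : V.PosDef) (x : E n) :
    act V⁻¹ (act V x) = x := by
  rw [act_act, Matrix.nonsing_inv_mul _ ((Matrix.isUnit_iff_isUnit_det _).1 hV.isUnit), act_one]

theorem act_act_inv {V : Matrix (Fin n) (Fin n) ℝ} (hV : V.PosDef) (x : E n) :
    act V (act V⁻¹ x) = x := by
  rw [act_act, Matrix.mul_nonsing_inv _ ((Matrix.isUnit_iff_isUnit_det _).1 hV.isUnit), act_one]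

theorem inner_mulVec_nonneg {ι : Type*} [Fintype ι] {V : Matrix ι ι ℝ}
    (hV : V.PosDef) (x : EuclideanSpace ℝ ι) :
    0 ≤ inner ℝ x (WithLp.toLp 2 (V.mulVec x.ofLp)) := by
  simpa [inner_eq_dotProduct] using hV.posSemidef.dotProduct_mulVec_nonneg x.ofLp

theorem inner_act_self_nonneg {V : Matrix (Fin n) (Fin n) ℝ} (hV : V.PosDef) (x : E n) :
    0 ≤ inner ℝ x (act V x) := inner_mulVec_nonneg hV x

theorem wnorm_sq {V : Matrix (Fin n) (Fin n) ℝ} (hV : V.PosDef) (x : E n) :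
    wnorm V x ^ 2 = inner ℝ x (act V x) :=
  Real.sq_sqrt (inner_act_self_nonneg hV x)

/-- The quadratic form of a positive definite matrix dominates a multiple of the squared norm. -/
theorem exists_pos_mul_norm_sq_le {ι : Type*} [Fintype ι] {V : Matrix ι ι ℝ} (hV : V.PosDef) :
    ∃ c > 0, ∀ x : EuclideanSpace ℝ ι,
      c * ‖x‖ ^ 2 ≤ inner ℝ x (WithLp.toLp 2 (V.mulVec x.ofLp)) := by
  set q : EuclideanSpace ℝ ι → ℝ := fun x => inner ℝ x (WithLp.toLp 2 (V.mulVec x.ofLp)) with hq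
  have hqc : Continuous q := by
    simp only [hq]; fun_prop
  -- The constant is the minimum of the form on the unit sphere, which is empty in dimension zero.
  rcases (Metric.sphere (0 : EuclideanSpace ℝ ι) 1).eq_empty_or_nonempty with he | hne
  · refine ⟨1, one_pos, fun x => ?_⟩
    have hx : x = 0 := by
      by_contra hx
      have : (‖x‖⁻¹ • x) ∈ Metric.sphere (0 : EuclideanSpace ℝ ι) 1 := by
        simp [norm_smul, hx]
      simp [he] at this
    simp [hx]
  · obtain ⟨x₀, hx₀, hmin⟩ :=
      (isCompact_sphere (0 : EuclideanSpace ℝ ι) 1).exists_isMinOn hne hqc.continuousOn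
    have hx₀0 : x₀ ≠ 0 := by
      rintro rfl; simp at hx₀
    refine ⟨q x₀, ?_, fun x => ?_⟩
    · have := hV.dotProduct_mulVec_pos (x := x₀.ofLp) (by simpa using hx₀0)
      simpa [hq, inner_eq_dotProduct] using this
    · rcases eq_or_ne x 0 with rfl | hx
      · simp
      · have hs : (‖x‖⁻¹ • x) ∈ Metric.sphere (0 : EuclideanSpace ℝ ι) 1 := by
          simp [norm_smul, hx]
        have h1 : q x₀ ≤ q (‖x‖⁻¹ • x) := hmin hs
        have h2 : q (‖x‖⁻¹ • x) = ‖x‖⁻¹ ^ 2 * q x := by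
          simp only [hq, inner_eq_dotProduct, WithLp.ofLp_smul, Matrix.mulVec_smul,
            dotProduct_smul, smul_dotProduct, smul_eq_mul]
          ring
        have hx' : 0 < ‖x‖ := norm_pos_iff.2 hx
        have h3 : q x = ‖x‖ ^ 2 * (‖x‖⁻¹ ^ 2 * q x) := by field_simp
        change q x₀ * ‖x‖ ^ 2 ≤ q x
        rw [h3, ← h2, mul_comm]
        gcongr

/-- The Cauchy-Schwarz inequality for a weighted norm and its dual norm. -/
theorem inner_le_wnorm_mul_wnorm {Q : Matrix (Fin n) (Fin n) ℝ} (hQ : Q.PosDef) (a b : E n) :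
    inner ℝ a b ≤ wnorm Q⁻¹ a * wnorm Q b := by
  have hA : wnorm Q⁻¹ a ^ 2 = inner ℝ a (act Q⁻¹ a) := wnorm_sq hQ.inv a
  have hB : wnorm Q b ^ 2 = inner ℝ b (act Q b) := wnorm_sq hQ b
  -- The quadratic in t is ‖a - tQb‖² in the metric of Q⁻¹; its discriminant gives the claim.
  have hpoly : ∀ t : ℝ, 0 ≤ inner ℝ b (act Q b) * (t * t) + (-2 * inner ℝ a b) * t
      + inner ℝ a (act Q⁻¹ a) := by
    intro t
    have h := inner_act_self_nonneg hQ.inv (a - t • act Q b)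
    have h1 : inner ℝ (act Q b) (act Q⁻¹ a) = inner ℝ a b := by
      rw [inner_act_left, transpose_eq_of_posDef hQ, act_act_inv hQ, real_inner_comm]
    have h2 : inner ℝ (act Q b) b = inner ℝ b (act Q b) := real_inner_comm _ _
    simp only [act_sub, act_smul, act_inv_act hQ, inner_sub_left, inner_sub_right,
      real_inner_smul_left, real_inner_smul_right, h1, h2] at h
    linarith
  have hd := discrim_le_zero hpoly
  unfold discrim at hd
  rw [← hA, ← hB] at hd
  refine le_of_abs_le (abs_le_of_sq_le_sq ?_
    (mul_nonneg (Real.sqrt_nonneg _) (Real.sqrt_nonneg _)))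
  nlinarith

end LinearAlgebra

/-! ### Block quadratic forms and Schur complements -/

section Blocks

variable {r n : ℕ}

theorem inner_stack_fromBlocks (A : Matrix (Fin r) (Fin r) ℝ) (B : Matrix (Fin r) (Fin n) ℝ)
    (C : Matrix (Fin n) (Fin r) ℝ) (D : Matrix (Fin n) (Fin n) ℝ) (w : E r × E n) :
    inner ℝ (stack w) (WithLp.toLp 2 ((Matrix.fromBlocks A B C D).mulVec (stack w).ofLp)) =
      inner ℝ w.1 (act A w.1) + inner ℝ w.1 (act B w.2) + inner ℝ w.2 (act C w.1)
        + inner ℝ w.2 (act D w.2) := by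
  simp only [inner_eq_dotProduct, stack, act, Matrix.fromBlocks_mulVec]
  simp [dotProduct, Fintype.sum_sum_type, mul_add, Finset.sum_add_distrib]
  ring

theorem blockNorm_sq {W : Matrix (Fin r ⊕ Fin n) (Fin r ⊕ Fin n) ℝ} (hW : W.PosDef)
    (w : E r × E n) :
    blockNorm W w ^ 2 = inner ℝ (stack w) (WithLp.toLp 2 (W.mulVec (stack w).ofLp)) :=
  Real.sq_sqrt (inner_mulVec_nonneg hW _)

theorem norm_stack_sq (w : E r × E n) : ‖stack w‖ ^ 2 = ‖w.1‖ ^ 2 + ‖w.2‖ ^ 2 := by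
  simp [EuclideanSpace.norm_sq_eq, stack, Fintype.sum_sum_type]

/-- Completing the square: with w = u + A⁻¹Bv the form is ⟨w, Aw⟩ plus the Schur complement
evaluated at v. If v = 0, then u ≠ 0 and ⟨u, Au⟩ is positive. -/
theorem posDef_fromBlocks {A : Matrix (Fin r) (Fin r) ℝ} {B : Matrix (Fin r) (Fin n) ℝ}
    {D : Matrix (Fin n) (Fin n) ℝ} (hA : A.PosDef)
    (h : (D - B.transpose * A⁻¹ * B).PosDef) :
    (Matrix.fromBlocks A B B.transpose D).PosDef := by
  have hAi := hA.inv
  have hAt := transpose_eq_of_posDef hA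
  have hAit : A⁻¹.transpose = A⁻¹ := transpose_eq_of_posDef hAi
  have hDt : D.transpose = D := by
    have h1 := transpose_eq_of_posDef h
    have h2 : (B.transpose * A⁻¹ * B).transpose = B.transpose * A⁻¹ * B := by
      simp [Matrix.transpose_mul, hAit, Matrix.mul_assoc]
    rw [Matrix.transpose_sub, h2] at h1
    exact sub_left_inj.1 h1
  refine Matrix.PosDef.of_dotProduct_mulVec_pos ?_ fun x hx => ?_
  · rw [Matrix.IsHermitian, Matrix.conjTranspose_eq_transpose_of_trivial,
      Matrix.fromBlocks_transpose, hAt, hDt, Matrix.transpose_transpose]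
  · set u : E r := WithLp.toLp 2 (x ∘ Sum.inl)
    set v : E n := WithLp.toLp 2 (x ∘ Sum.inr)
    have hst : (stack (u, v)).ofLp = x := by
      simp [stack, u, v]
    have key := inner_stack_fromBlocks A B B.transpose D (u, v)
    rw [inner_eq_dotProduct, hst] at key
    simp only at key
    rw [star_trivial, key]
    set w : E r := u + act A⁻¹ (act B v)
    have h1 : inner ℝ w (act A w) = inner ℝ u (act A u) + 2 * inner ℝ u (act B v)
        + inner ℝ v (act (B.transpose * A⁻¹ * B) v) := by
      have e1 : inner ℝ (act A⁻¹ (act B v)) (act A u) = inner ℝ u (act B v) := by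
        rw [inner_act_comm hA, act_act_inv hA]
      have e2 : inner ℝ (act A⁻¹ (act B v)) (act B v) =
          inner ℝ v (act (B.transpose * A⁻¹ * B) v) := by
        rw [← act_act, ← act_act, inner_act_right B.transpose, Matrix.transpose_transpose,
          real_inner_comm]
      simp only [w, act_add, inner_add_left, inner_add_right, act_act_inv hA, e1, e2]
      ring
    have h2 : inner ℝ v (act B.transpose u) = inner ℝ u (act B v) := by
      rw [inner_act_right, Matrix.transpose_transpose, real_inner_comm]
    have h3 : inner ℝ v (act D v) = inner ℝ v (act (D - B.transpose * A⁻¹ * B) v)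
        + inner ℝ v (act (B.transpose * A⁻¹ * B) v) := by
      rw [sub_act, inner_sub_right]; ring
    rw [h2, h3]
    have hw := inner_act_self_nonneg hA w
    rcases eq_or_ne v 0 with hv | hv
    · have hu : u ≠ 0 := by
        rintro hu
        apply hx
        rw [← hst, hu, hv]
        ext i; cases i <;> simp [stack]
      have := hA.dotProduct_mulVec_pos (x := u.ofLp) (by simpa using hu)
      have h4 : 0 < inner ℝ u (act A u) := by simpa [inner_eq_dotProduct, act] using this
      have h5 : ∀ {k} (M : Matrix (Fin k) (Fin n) ℝ), act M v = 0 := by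
        intro k M; rw [hv]; ext i; simp [act]
      simp only [h5, inner_zero_right]
      linarith
    · have := h.dotProduct_mulVec_pos (x := v.ofLp) (by simpa using hv)
      have h4 : 0 < inner ℝ v (act (D - B.transpose * A⁻¹ * B) v) := by
        simpa [inner_eq_dotProduct, act] using this
      linarith

end Blocks

/-! ### Conjugates, subgradients and proximal points -/

section ConvexAnalysis

variable {n : ℕ} {φ : E n → EReal}

theorem exists_eq_coe_of_le_coe {a : EReal} {s : ℝ} (ha : a ≠ ⊥) (has : a ≤ s) :
    ∃ t : ℝ, a = t ∧ t ≤ s := by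
  induction a with
  | bot => exact absurd rfl ha
  | top => exact absurd has (by simp)
  | coe t => exact ⟨t, rfl, by exact_mod_cast has⟩

theorem coe_le_add_of_forall {a b : EReal} {c : ℝ} (ha : a ≠ ⊥) (hb : b ≠ ⊥)
    (h : ∀ s t : ℝ, a ≤ s → b ≤ t → c ≤ s + t) : (c : EReal) ≤ a + b := by
  induction a with
  | bot => exact absurd rfl ha
  | top => rw [EReal.top_add_of_ne_bot hb]; exact le_top
  | coe s =>
    induction b with
    | bot => exact absurd rfl hb
    | top => rw [EReal.add_top_of_ne_bot ha]; exact le_top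
    | coe t => exact_mod_cast h s t le_rfl le_rfl

/-- Two lower bounds whose sum is already an upper bound of the sum are both tight. This splits
optimality of the dual value into two Fenchel-Young equalities. -/
theorem le_of_add_le_coe {a b : EReal} {s t : ℝ} (ha : (s : EReal) ≤ a) (hb : (t : EReal) ≤ b)
    (h : a + b ≤ ((s + t : ℝ) : EReal)) : a ≤ s ∧ b ≤ t := by
  induction a with
  | bot => simp at ha
  | top =>
    rw [EReal.top_add_of_ne_bot (by rintro rfl; simp at hb)] at h
    exact absurd h (EReal.coe_lt_top _).not_ge
  | coe s' =>
    induction b with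
    | bot => simp at hb
    | top =>
      rw [EReal.add_top_of_ne_bot (EReal.coe_ne_bot _)] at h
      exact absurd h (EReal.coe_lt_top _).not_ge
    | coe t' =>
      norm_cast at *
      constructor <;> linarith

theorem ProperClosedConvex.exists_coe (hφ : ProperClosedConvex φ) {x : E n} (hx : x ∈ dom φ) :
    ∃ t : ℝ, φ x = t :=
  ⟨(φ x).toReal, (EReal.coe_toReal (ne_of_lt hx) (hφ.ne_bot x)).symm⟩

theorem ProperClosedConvex.isClosed_epigraph (hφ : ProperClosedConvex φ) :
    IsClosed {p : E n × ℝ | φ p.1 ≤ (p.2 : EReal)} :=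
  hφ.closed.isClosed_epigraph.preimage
    (continuous_fst.prodMk (continuous_coe_real_ereal.comp continuous_snd))

/-- A continuous linear functional on `ℝⁿ × ℝ` in coordinates. -/
theorem exists_inner_add_mul (F : StrongDual ℝ (E n × ℝ)) :
    ∃ (w : E n) (α : ℝ), ∀ x t, F (x, t) = inner ℝ w x + α * t := by
  refine ⟨(InnerProductSpace.toDual ℝ (E n)).symm (F.comp (.inl ℝ (E n) ℝ)), F (0, 1), ?_⟩
  intro x t
  have h : ((x, t) : E n × ℝ) = (x, 0) + t • (0, 1) := by simp
  rw [h, map_add, map_smul, InnerProductSpace.toDual_symm_apply]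
  simp [mul_comm]

theorem exists_affine_minorant_of_separation {w : E n} {α u : ℝ} (hα : 0 < α) {x₀ : E n} {s : ℝ}
    (hlt : inner ℝ w x₀ + α * s < u)
    (hsep : ∀ y (t : ℝ), φ y ≤ t → u < inner ℝ w y + α * t) :
    ∃ (v : E n) (c : ℝ), (∀ y (t : ℝ), φ y ≤ t → inner ℝ v y - c ≤ t) ∧
      s < inner ℝ v x₀ - c := by
  refine ⟨-(α⁻¹ • w), -(α⁻¹ * u), fun y t ht => ?_, ?_⟩
  · have h := hsep y t ht
    have h2 : α⁻¹ * u < α⁻¹ * (inner ℝ w y + α * t) := by gcongr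
    rw [mul_add, inv_mul_cancel_left₀ hα.ne'] at h2
    rw [inner_neg_left, real_inner_smul_left]
    linarith
  · have h2 : α⁻¹ * (inner ℝ w x₀ + α * s) < α⁻¹ * u := by gcongr
    rw [mul_add, inv_mul_cancel_left₀ hα.ne'] at h2
    rw [inner_neg_left, real_inner_smul_left]
    linarith

/-- Hahn-Banach separates (x₀, s) from the closed epigraph; since the epigraph is unbounded upwards,
the vertical coefficient cannot be negative. -/
theorem ProperClosedConvex.exists_separation (hφ : ProperClosedConvex φ) {x₀ : E n} {s : ℝ}
    (hs : (s : EReal) < φ x₀) :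
    ∃ (w : E n) (α u : ℝ), 0 ≤ α ∧ inner ℝ w x₀ + α * s < u ∧
      ∀ y (t : ℝ), φ y ≤ t → u < inner ℝ w y + α * t := by
  obtain ⟨F, u, h1, h2⟩ := geometric_hahn_banach_point_closed (x := (x₀, s)) hφ.convex
    hφ.isClosed_epigraph (by simpa using hs)
  obtain ⟨w, α, hF⟩ := exists_inner_add_mul F
  refine ⟨w, α, u, ?_, by rwa [← hF], fun y t ht => by rw [← hF]; exact h2 (y, t) ht⟩
  by_contra! hα
  obtain ⟨x₁, hx₁⟩ := hφ.dom_nonempty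
  obtain ⟨t, ht⟩ := hφ.exists_coe hx₁
  set k : ℝ := max t ((u - inner ℝ w x₁) / α)
  have h3 := h2 (x₁, k) (by simp [ht, k])
  rw [hF] at h3
  have h4 : (u - inner ℝ w x₁) / α ≤ k := le_max_right _ _
  rw [div_le_iff_of_neg hα] at h4
  linarith

/-- A proper closed convex function is the supremum of its affine minorants. -/
theorem ProperClosedConvex.exists_affine_minorant (hφ : ProperClosedConvex φ) {x₀ : E n} {s : ℝ}
    (hs : (s : EReal) < φ x₀) :
    ∃ (v : E n) (c : ℝ), (∀ y (t : ℝ), φ y ≤ t → inner ℝ v y - c ≤ t) ∧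
      s < inner ℝ v x₀ - c := by
  obtain ⟨w, α, u, hα, hlt, hsep⟩ := hφ.exists_separation hs
  rcases hα.lt_or_eq with hα | rfl
  · exact exists_affine_minorant_of_separation hα hlt hsep
  -- A vertical hyperplane separates x₀ from the domain. Separating just below the graph at a domain
  -- point gives a genuine affine minorant; adding a large multiple `k` of the vertical functional
  -- keeps it a minorant and lifts it above s at x₀.
  · obtain ⟨x₁, hx₁⟩ := hφ.dom_nonempty
    obtain ⟨t₁, ht₁⟩ := hφ.exists_coe hx₁
    obtain ⟨w₁, α₁, u₁, hα₁, hlt₁, hsep₁⟩ := hφ.exists_separation (x₀ := x₁) (s := t₁ - 1)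
      (by rw [ht₁]; exact_mod_cast sub_one_lt t₁)
    have hα₁' : 0 < α₁ := by
      have := hsep₁ x₁ t₁ ht₁.le
      nlinarith
    obtain ⟨v₀, c₀, hv₀, -⟩ := exists_affine_minorant_of_separation hα₁' hlt₁ hsep₁
    simp only [zero_mul, add_zero] at hlt hsep
    set δ := u - inner ℝ w x₀
    have hδ : 0 < δ := by simp only [δ]; linarith
    set k : ℝ := max 0 ((s - (inner ℝ v₀ x₀ - c₀)) / δ + 1)
    have hk0 : 0 ≤ k := le_max_left _ _
    have hk : s - (inner ℝ v₀ x₀ - c₀) < k * δ := by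
      have : (s - (inner ℝ v₀ x₀ - c₀)) / δ < k := lt_of_lt_of_le (lt_add_one _) (le_max_right _ _)
      rwa [div_lt_iff₀ hδ] at this
    refine ⟨v₀ - k • w, c₀ - k * u, fun y t ht => ?_, ?_⟩
    · have h1 := hv₀ y t ht
      have h2 := hsep y t ht
      rw [inner_sub_left, real_inner_smul_left]
      nlinarith
    · rw [inner_sub_left, real_inner_smul_left]
      simp only [δ] at hk
      linarith

/-- Testing against real upper bounds of φ(x) discards the points where φ = +∞ and avoids
extended-real subtraction; `HasSubgradient` has the same form. -/
theorem conj_le_coe_iff (hφ : ∀ x, φ x ≠ ⊥) {v : E n} {c : ℝ} :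
    conj φ v ≤ c ↔ ∀ x (s : ℝ), φ x ≤ s → inner ℝ v x - s ≤ c := by
  rw [conj, iSup_le_iff]
  refine forall_congr' fun x => ?_
  have hx := hφ x
  induction hφx : φ x with
  | bot => exact absurd hφx hx
  | top => simp
  | coe t =>
    norm_cast
    exact ⟨fun h s hs => by linarith, fun h => h t le_rfl⟩

theorem coe_le_conj {v x : E n} {a : ℝ} (hx : φ x = a) :
    ((inner ℝ v x - a : ℝ) : EReal) ≤ conj φ v := by
  have := le_iSup (fun x : E n => ((inner ℝ v x : ℝ) : EReal) - φ x) x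
  rw [hx] at this
  exact_mod_cast this

/-- The slope of an affine minorant of φ lies in the domain of the conjugate, which is otherwise a
supremum of affine functions. -/
theorem ProperClosedConvex.conj (hφ : ProperClosedConvex φ) : ProperClosedConvex (conj φ) where
  ne_bot v := by
    obtain ⟨x, hx⟩ := hφ.dom_nonempty
    obtain ⟨t, ht⟩ := hφ.exists_coe hx
    exact ((EReal.bot_lt_coe _).trans_le (coe_le_conj (v := v) ht)).ne'
  dom_nonempty := by
    obtain ⟨x, hx⟩ := hφ.dom_nonempty
    obtain ⟨t, ht⟩ := hφ.exists_coe hx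
    obtain ⟨v, c, hvc, -⟩ := hφ.exists_affine_minorant (x₀ := x) (s := t - 1)
      (by rw [ht]; exact_mod_cast sub_one_lt t)
    exact ⟨v, lt_of_le_of_lt ((conj_le_coe_iff hφ.ne_bot (c := c)).2
      fun y s hs => by linarith [hvc y s hs]) (EReal.coe_lt_top c)⟩
  closed := by
    refine lowerSemicontinuous_iSup fun x => ?_
    induction hφx : φ x with
    | bot => exact absurd hφx (hφ.ne_bot x)
    | top => simpa using lowerSemicontinuous_const
    | coe t =>
      refine Continuous.lowerSemicontinuous ?_
      have : Continuous fun v : E n => ((inner ℝ v x - t : ℝ) : EReal) :=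
        continuous_coe_real_ereal.comp (by fun_prop)
      simpa using this
  convex := by
    rintro ⟨v, a⟩ hv ⟨w, b⟩ hw α β hα hβ hαβ
    simp only [Set.mem_ofPred_eq, Prod.fst_add, Prod.smul_fst, Prod.snd_add, Prod.smul_snd,
      conj_le_coe_iff hφ.ne_bot, smul_eq_mul] at hv hw ⊢
    intro x s hs
    have h1 := mul_le_mul_of_nonneg_left (hv x s hs) hα
    have h2 := mul_le_mul_of_nonneg_left (hw x s hs) hβ
    rw [inner_add_left, real_inner_smul_left, real_inner_smul_left]
    have : s = α * s + β * s := by rw [← add_mul, hαβ, one_mul]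
    linarith

/-- `φ(x) = a` and `v` is a subgradient of `φ` at `x`. -/
def HasSubgradient (φ : E n → EReal) (a : ℝ) (v x : E n) : Prop :=
  φ x = a ∧ ∀ y (s : ℝ), φ y ≤ s → a + inner ℝ v (y - x) ≤ s

theorem HasSubgradient.conj_eq (hφ : ∀ x, φ x ≠ ⊥) {a : ℝ} {v x : E n}
    (h : HasSubgradient φ a v x) : conj φ v = ((inner ℝ v x - a : ℝ) : EReal) := by
  refine le_antisymm ((conj_le_coe_iff hφ).2 fun y s hs => ?_) (coe_le_conj h.1)
  have := h.2 y s hs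
  rw [inner_sub_right] at this
  linarith

theorem HasSubgradient.conj (hφ : ∀ x, φ x ≠ ⊥) {a : ℝ} {v x : E n}
    (h : HasSubgradient φ a v x) : HasSubgradient (conj φ) (inner ℝ v x - a) x v := by
  refine ⟨h.conj_eq hφ, fun w s hs => ?_⟩
  have := (conj_le_coe_iff hφ).1 hs x a h.1.le
  rw [inner_sub_right, real_inner_comm w x, real_inner_comm v x]
  linarith

theorem ProperClosedConvex.le_of_biconj_le (hφ : ProperClosedConvex φ) {x : E n} {a : ℝ}
    (h : ∀ v (s : ℝ), TriPD.conj φ v ≤ s → inner ℝ v x - s ≤ a) : φ x ≤ a := by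
  by_contra! hlt
  obtain ⟨v, c, hvc, hgt⟩ := hφ.exists_affine_minorant hlt
  have := h v c ((conj_le_coe_iff hφ.ne_bot).2 fun y s hs => by linarith [hvc y s hs])
  linarith

/-- This is where closedness of φ enters: φ ≤ φ** (`le_of_biconj_le`) turns x ∈ ∂φ*(u) back into u ∈
∂φ(x). -/
theorem HasSubgradient.of_conj (hφ : ProperClosedConvex φ) {b : ℝ} {x u : E n}
    (h : HasSubgradient (TriPD.conj φ) b x u) : HasSubgradient φ (inner ℝ u x - b) u x := by
  have hb := (conj_le_coe_iff hφ.ne_bot).1 h.1.le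
  have hle : φ x ≤ ((inner ℝ u x - b : ℝ) : EReal) := by
    refine hφ.le_of_biconj_le fun w s hs => ?_
    have := h.2 w s hs
    rw [inner_sub_right, real_inner_comm w x, real_inner_comm u x] at this
    linarith
  obtain ⟨a, ha, hab⟩ := exists_eq_coe_of_le_coe (hφ.ne_bot x) hle
  have hba := hb x a ha.le
  obtain rfl : a = inner ℝ u x - b := le_antisymm hab (by linarith)
  refine ⟨ha, fun y s hs => ?_⟩
  have := hb y s hs
  rw [inner_sub_right]
  linarith

theorem HasSubgradient.monotone {a b : ℝ} {v w x y : E n} (hx : HasSubgradient φ a v x)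
    (hy : HasSubgradient φ b w y) : 0 ≤ inner ℝ (v - w) (x - y) := by
  have h1 := hx.2 y b hy.1.le
  have h2 := hy.2 x a hx.1.le
  simp only [inner_sub_left, inner_sub_right] at *
  linarith

/-- The subdifferential of a proper closed convex function has a closed graph. -/
theorem HasSubgradient.of_tendsto (hφ : ProperClosedConvex φ) {a : ℕ → ℝ} {v x : ℕ → E n}
    {v₀ x₀ : E n} (h : ∀ k, HasSubgradient φ (a k) (v k) (x k))
    (hv : Tendsto v atTop (𝓝 v₀)) (hx : Tendsto x atTop (𝓝 x₀)) :
    ∃ a₀, HasSubgradient φ a₀ v₀ x₀ := by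
  -- The values `a k` are not assumed to converge; the subgradient inequality puts points free of
  -- them into the closed epigraph, and the limit stays there.
  have key : ∀ y (s : ℝ), φ y ≤ s → φ x₀ ≤ ((s - inner ℝ v₀ (y - x₀) : ℝ) : EReal) := by
    intro y s hs
    have hlim : Tendsto (fun k => (x k, s - inner ℝ (v k) (y - x k))) atTop
        (𝓝 (x₀, s - inner ℝ v₀ (y - x₀))) :=
      hx.prodMk_nhds (tendsto_const_nhds.sub (hv.inner (tendsto_const_nhds.sub hx)))
    refine hφ.isClosed_epigraph.mem_of_tendsto hlim (Eventually.of_forall fun k => ?_)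
    change φ (x k) ≤ _
    rw [(h k).1]
    have := (h k).2 y s hs
    exact_mod_cast by linarith
  obtain ⟨x₁, hx₁⟩ := hφ.dom_nonempty
  obtain ⟨t, ht⟩ := hφ.exists_coe hx₁
  obtain ⟨a₀, ha₀, -⟩ := exists_eq_coe_of_le_coe (hφ.ne_bot x₀) (key x₁ t ht.le)
  refine ⟨a₀, ha₀, fun y s hs => ?_⟩
  have := key y s hs
  rw [ha₀] at this
  have h2 : a₀ ≤ s - inner ℝ v₀ (y - x₀) := by exact_mod_cast this
  linarith

/-- First-order optimality for the sum of a convex and a differentiable function. -/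
theorem add_inner_le_of_isMin {C : Set (E n × ℝ)} (hC : Convex ℝ C) {x : E n} {a : ℝ}
    (hx : (x, a) ∈ C) {ψ : E n → ℝ} {d : E n} (hψ : HasGradientAt ψ d x)
    (hmin : ∀ y s, (y, s) ∈ C → a + ψ x ≤ s + ψ y) {y : E n} {s : ℝ} (hy : (y, s) ∈ C) :
    a + inner ℝ (-d) (y - x) ≤ s := by
  have hline : HasDerivAt (fun t : ℝ => x + t • (y - x)) (y - x) 0 := by
    simpa using ((hasDerivAt_id (0 : ℝ)).smul_const (y - x)).const_add x
  -- Along the segment, convexity of C replaces the nonsmooth part by its chord, so this function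
  -- has nonnegative slopes to the right of 0.
  have hderiv : HasDerivAt (fun t : ℝ => ψ (x + t • (y - x)) + t * (s - a))
      (inner ℝ d (y - x) + (s - a)) 0 := by
    have h1 : HasFDerivAt ψ (InnerProductSpace.toDual ℝ (E n) d) (x + (0 : ℝ) • (y - x)) := by
      simpa using hψ.hasFDerivAt
    have h2 := h1.comp_hasDerivAt (0 : ℝ) hline
    have h3 := (hasDerivAt_id (0 : ℝ)).mul_const (s - a)
    have h4 := h2.add h3
    simp only [InnerProductSpace.toDual_apply_apply, one_mul] at h4
    exact h4
  have hslope := hderiv.tendsto_slope_zero_right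
  have hnonneg : 0 ≤ inner ℝ d (y - x) + (s - a) := by
    refine ge_of_tendsto hslope ?_
    filter_upwards [Ioo_mem_nhdsGT (zero_lt_one' ℝ)] with t ht
    have hmem : (x + t • (y - x), a + t * (s - a)) ∈ C := by
      have := hC hx hy (sub_nonneg.2 ht.2.le) ht.1.le (by ring)
      convert this using 1
      ext1
      · simp; module
      · simp; ring
    have := hmin _ _ hmem
    have h0 : 0 ≤ t⁻¹ := inv_nonneg.2 ht.1.le
    simp only [zero_add, zero_smul, add_zero, zero_mul, smul_eq_mul]
    exact mul_nonneg h0 (by linarith)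
  rw [inner_neg_left]
  linarith

/-- An affine minorant of φ loses to the quadratic at infinity, so a sublevel set is compact and the
lower semicontinuous objective attains its minimum on it. -/
theorem exists_isMin_add_quadratic (hφ : ProperClosedConvex φ) {V : Matrix (Fin n) (Fin n) ℝ}
    (hV : V.PosDef) (x : E n) :
    ∃ p, p ∈ argmin fun y => φ y + ((1 / 2 * wnorm V (x - y) ^ 2 : ℝ) : EReal) := by
  obtain ⟨x₁, hx₁⟩ := hφ.dom_nonempty
  obtain ⟨t₁, ht₁⟩ := hφ.exists_coe hx₁
  obtain ⟨v, c, hvc, -⟩ := hφ.exists_affine_minorant (x₀ := x₁) (s := t₁ - 1)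
    (by rw [ht₁]; exact_mod_cast sub_one_lt t₁)
  obtain ⟨κ, hκ, hκV⟩ := exists_pos_mul_norm_sq_le hV
  set q : E n → ℝ := fun y => 1 / 2 * wnorm V (x - y) ^ 2 with hq
  have hqV : ∀ y, q y = 1 / 2 * inner ℝ (x - y) (act V (x - y)) := fun y => by
    rw [hq, ← wnorm_sq hV]
  have hqc : Continuous q := by
    have h : q = fun y => 1 / 2 * inner ℝ (x - y) (act V (x - y)) := funext hqV
    have := continuous_act V
    rw [h]; fun_prop
  set M : ℝ := t₁ + q x₁
  -- The sublevel set of the objective at the level `M`, through the epigraph of `φ`.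
  set K : Set (E n) := {y | φ y ≤ ((M - q y : ℝ) : EReal)}
  have hKclosed : IsClosed K :=
    hφ.isClosed_epigraph.preimage (continuous_id.prodMk (continuous_const.sub hqc))
  have hKbdd : Bornology.IsBounded K := by
    -- On K, ρ = ‖x - y‖ satisfies κρ² ≤ 2(A + ‖v‖ρ). The radius below forces ρ > 1 and κρ > 2(|A| +
    -- ‖v‖) outside the ball, which contradicts this.
    set A : ℝ := M + c + ‖v‖ * ‖x‖
    refine (Metric.isBounded_closedBall (x := x)
      (r := 1 + 2 * (|A| + ‖v‖) / κ)).subset fun y hy => ?_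
    have h1 := hvc y _ hy
    have h2 : κ * ‖x - y‖ ^ 2 ≤ 2 * q y := by
      rw [hqV]; have := hκV (x - y); unfold act; linarith
    have h3 : -(‖v‖ * ‖x‖ + ‖v‖ * ‖x - y‖) ≤ inner ℝ v y := by
      have e : inner ℝ v y = inner ℝ v x - inner ℝ v (x - y) := by rw [inner_sub_right]; ring
      have e1 := (abs_le.1 (abs_real_inner_le_norm v x)).1
      have e2 := (abs_le.1 (abs_real_inner_le_norm v (x - y))).2
      linarith
    rw [Metric.mem_closedBall, dist_comm, dist_eq_norm]
    by_contra! hlt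
    set ρ := ‖x - y‖
    have hnn : 0 ≤ 2 * (|A| + ‖v‖) / κ := by positivity
    have hρ : 1 < ρ := by linarith
    have h4 : 2 * (|A| + ‖v‖) < κ * ρ := by
      have : 2 * (|A| + ‖v‖) / κ < ρ := by linarith
      rw [div_lt_iff₀ hκ] at this
      linarith
    have h5 : κ * ρ ^ 2 ≤ 2 * (|A| + ‖v‖ * ρ) := by
      have := le_abs_self A
      simp only [A] at *
      linarith
    have h6 : 2 * (|A| + ‖v‖ * ρ) ≤ 2 * (|A| + ‖v‖) * ρ := by
      have := abs_nonneg A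
      nlinarith
    nlinarith
  have hKcompact : IsCompact K := Metric.isCompact_of_isClosed_isBounded hKclosed hKbdd
  have hx₁K : x₁ ∈ K := by
    change φ x₁ ≤ _
    rw [ht₁]
    exact_mod_cast (by simp [M] : t₁ ≤ M - q x₁)
  set F : E n → EReal := fun y => φ y + ((q y : ℝ) : EReal) with hF
  have hFlsc : LowerSemicontinuous F := by
    intro y
    exact LowerSemicontinuousAt.add' (hφ.closed y)
      ((continuous_coe_real_ereal.comp hqc).lowerSemicontinuous y)
      (EReal.continuousAt_add (by simp) (by simp))
  obtain ⟨p, hpK, hpmin⟩ := LowerSemicontinuousOn.exists_isMinOn ⟨x₁, hx₁K⟩ hKcompact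
    (hFlsc.lowerSemicontinuousOn K)
  have hmemK : ∀ y, F y ≤ M → y ∈ K := by
    intro y hy
    have hb := hφ.ne_bot y
    simp only [hF] at hy
    change φ y ≤ _
    induction hφy : φ y with
    | bot => exact absurd hφy hb
    | top => rw [hφy] at hy; simp at hy
    | coe t =>
      rw [hφy] at hy
      have : t + q y ≤ M := by exact_mod_cast hy
      exact_mod_cast by linarith
  have hFx₁ : F x₁ = M := by simp [hF, ht₁, M]
  have hall : ∀ y, F p ≤ F y := by
    intro y
    rcases le_or_gt (F y) M with h | h
    · exact hpmin (hmemK y h)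
    · exact ((hpmin hx₁K).trans hFx₁.le).trans h.le
  exact ⟨p, lt_of_le_of_lt ((hall x₁).trans hFx₁.le) (EReal.coe_lt_top M), hall⟩

theorem hasGradientAt_half_wnorm_sq {V : Matrix (Fin n) (Fin n) ℝ} (hV : V.PosDef) (x p : E n) :
    HasGradientAt (fun y => 1 / 2 * wnorm V (x - y) ^ 2) (-act V (x - p)) p := by
  set A : E n →L[ℝ] E n :=
    LinearMap.toContinuousLinearMap ⟨⟨act V, act_add V⟩, fun c y => act_smul V c y⟩
  have hA : ∀ y, A y = act V y := fun _ => rfl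
  have h1 : HasFDerivAt (fun y : E n => x - y) (-ContinuousLinearMap.id ℝ (E n)) p :=
    (hasFDerivAt_id p).const_sub x
  have h2 := (h1.inner ℝ (A.hasFDerivAt.comp p h1)).const_mul (1 / 2 : ℝ)
  rw [hasGradientAt_iff_hasFDerivAt]
  have hfun : (fun y => 1 / 2 * wnorm V (x - y) ^ 2) =
      fun y => 1 / 2 * inner ℝ (x - y) (A (x - y)) :=
    funext fun y => by rw [wnorm_sq hV, hA]
  rw [hfun]
  refine h2.congr_fderiv ?_
  ext w
  have h3 : inner ℝ (act V w) (x - p) = inner ℝ w (act V (x - p)) := by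
    rw [real_inner_comm, inner_act_comm hV]
  simp [hA, real_inner_comm, fderivInnerCLM_apply, h3]
  ring

/-- Existence of a minimizer is enough to use the chosen point; only its first-order optimality
condition matters, not its uniqueness. -/
theorem prox_hasSubgradient (hφ : ProperClosedConvex φ) {V : Matrix (Fin n) (Fin n) ℝ}
    (hV : V.PosDef) (x : E n) :
    ∃ a, HasSubgradient φ a (act V (x - prox V φ x)) (prox V φ x) := by
  have hp : prox V φ x ∈ argmin fun y => φ y + ((1 / 2 * wnorm V (x - y) ^ 2 : ℝ) : EReal) :=
    Classical.epsilon_spec (exists_isMin_add_quadratic hφ hV x)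
  set p := prox V φ x
  obtain ⟨hdom, hmin⟩ := hp
  have hpd : p ∈ dom φ := by
    by_contra hnot
    have : φ p = ⊤ := by simpa [dom] using hnot
    have h1 : φ p + ((1 / 2 * wnorm V (x - p) ^ 2 : ℝ) : EReal) < ⊤ := hdom
    rw [this, EReal.top_add_of_ne_bot (EReal.coe_ne_bot _)] at h1
    exact lt_irrefl _ h1
  obtain ⟨a, ha⟩ := hφ.exists_coe hpd
  refine ⟨a, ha, fun y s hs => ?_⟩
  have := add_inner_le_of_isMin hφ.convex (x := p) (a := a) ha.le
    (hasGradientAt_half_wnorm_sq hV x p) (fun y s hs => ?_) (y := y) (s := s) hs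
  · rwa [neg_neg] at this
  · have h1 := hmin y
    simp only [ha] at h1
    have hs' : φ y ≤ s := hs
    have h2 := h1.trans (add_le_add_left hs' _)
    exact_mod_cast h2

end ConvexAnalysis

/-! ### Fenchel-Rockafellar duality and the KKT system -/

section Duality

variable {r n : ℕ}

/-- A segment ending in a relative interior point can be prolonged within the set. -/
theorem exists_prolongation {s : Set (E n)} {x₀ x : E n} (hx₀ : x₀ ∈ intrinsicInterior ℝ s)
    (hx : x ∈ s) : ∃ ε > 0, ∀ t ∈ Set.Icc (0 : ℝ) ε, x₀ - t • (x - x₀) ∈ s := by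
  obtain ⟨y, hy, rfl⟩ := mem_intrinsicInterior.1 hx₀
  have hxs : x ∈ affineSpan ℝ s := subset_affineSpan ℝ s hx
  have hmem : ∀ t : ℝ, AffineMap.lineMap (y : E n) x (-t) ∈ affineSpan ℝ s := fun t =>
    AffineMap.lineMap_mem _ y.2 hxs
  -- The prolonged line stays in the affine span, where the intrinsic interior is an ordinary
  -- interior.
  set γ : ℝ → affineSpan ℝ s := fun t => ⟨AffineMap.lineMap (y : E n) x (-t), hmem t⟩
  have hγ : Continuous γ := by
    refine Continuous.subtype_mk ?_ _
    exact AffineMap.lineMap_continuous.comp continuous_neg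
  have hγ0 : γ 0 = y := by ext1; simp [γ]
  have hnhds : γ ⁻¹' ((↑) ⁻¹' s) ∈ 𝓝 (0 : ℝ) :=
    hγ.continuousAt.preimage_mem_nhds (by rw [hγ0]; exact mem_interior_iff_mem_nhds.1 hy)
  obtain ⟨ε, hε, hball⟩ := Metric.mem_nhds_iff.1 hnhds
  refine ⟨ε / 2, half_pos hε, fun t ht => ?_⟩
  have h : t ∈ Metric.ball (0 : ℝ) ε := by
    rw [Metric.mem_ball, dist_zero_right, Real.norm_of_nonneg ht.1]
    linarith [ht.2]
  have h2 : (γ t : E n) ∈ s := hball h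
  convert h2 using 1
  simp [γ, AffineMap.lineMap_apply]
  abel

/-- A convex cone in `W × ℝ` whose projection to `W` is symmetric, and that meets the vertical
axis only in its nonnegative part, lies above the graph of a linear form. -/
theorem exists_linear_form_of_cone {W : Type*} [AddCommGroup W] [Module ℝ W]
    (K : Set (W × ℝ)) (hadd : ∀ p ∈ K, ∀ q ∈ K, p + q ∈ K)
    (hsmul : ∀ c : ℝ, 0 < c → ∀ p ∈ K, c • p ∈ K) (hzero : 0 ∈ K)
    (hneg : ∀ p ∈ K, ∃ t, (-p.1, t) ∈ K) (hvert : ∀ t, ((0 : W), t) ∈ K → 0 ≤ t) :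
    ∃ ℓ : W →ₗ[ℝ] ℝ, ∀ p ∈ K, ℓ p.1 ≤ p.2 := by
  -- Restricted to the projection D of the cone, every vertical line meets K, which is the
  -- cofinality condition of the Riesz extension theorem for the functional t on the vertical axis.
  let D : Submodule ℝ W :=
    { carrier := {w | ∃ t, (w, t) ∈ K}
      add_mem' := by
        rintro a b ⟨s, hs⟩ ⟨t, ht⟩
        exact ⟨s + t, hadd _ hs _ ht⟩
      zero_mem' := ⟨0, hzero⟩
      smul_mem' := by
        rintro c w ⟨t, ht⟩
        rcases lt_trichotomy c 0 with hc | rfl | hc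
        · obtain ⟨t', ht'⟩ := hneg _ ht
          exact ⟨-c * t', by simpa using hsmul (-c) (neg_pos.2 hc) _ ht'⟩
        · exact ⟨0, by rw [zero_smul]; exact hzero⟩
        · exact ⟨c * t, hsmul c hc _ ht⟩ }
  let C : PointedCone ℝ (D × ℝ) :=
    { carrier := {p | ((p.1 : W), p.2) ∈ K}
      add_mem' := fun {p q} hp hq => hadd _ hp _ hq
      zero_mem' := hzero
      smul_mem' := by
        rintro ⟨c, hc⟩ p hp
        rcases hc.lt_or_eq with hc | rfl
        · exact hsmul c hc _ hp
        · have : ((⟨0, hc⟩ : {c : ℝ // 0 ≤ c}) • p) = 0 := zero_smul ℝ p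
          rw [this]
          exact hzero }
  let F : (D × ℝ) →ₗ.[ℝ] ℝ :=
    { domain := Submodule.prod ⊥ ⊤
      toFun := LinearMap.snd ℝ D ℝ ∘ₗ (Submodule.subtype _) }
  obtain ⟨G, hGF, hGC⟩ := riesz_extension C F
    (by
      rintro ⟨⟨w, t⟩, hw⟩ hK
      have hw0 : w = 0 := hw.1
      subst hw0
      exact hvert t hK)
    (by
      rintro ⟨⟨w, s, hs⟩, t⟩
      refine ⟨⟨(0, s - t), rfl, trivial⟩, ?_⟩
      change (((0 + ⟨w, s, hs⟩ : D) : W), s - t + t) ∈ K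
      simpa using hs)
  have hG : ∀ t : ℝ, G (0, t) = t := fun t => hGF ⟨(0, t), rfl, trivial⟩
  -- The extension G is nonnegative on the cone and G(0, t) = t, so -G(·, 0) lies below the cone.
  obtain ⟨ℓ, hℓ⟩ := (-(G ∘ₗ LinearMap.inl ℝ D ℝ)).exists_extend
  refine ⟨ℓ, fun p hp => ?_⟩
  have h1 : 0 ≤ G (⟨p.1, p.2, hp⟩, p.2) := hGC _ hp
  have h2 : ((⟨p.1, p.2, hp⟩, p.2) : D × ℝ) = (⟨p.1, p.2, hp⟩, 0) + (0, p.2) := by simp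
  rw [h2, map_add, hG] at h1
  have h3 : ℓ p.1 = -G (⟨p.1, p.2, hp⟩, 0) := LinearMap.congr_fun hℓ ⟨p.1, p.2, hp⟩
  linarith

/-- Fenchel-Rockafellar duality under the relative interior qualification: if
`⟨w, ·⟩ + m ≤ g + h ∘ L` then the coupling constraint `y = Lx` admits a multiplier. -/
theorem exists_multiplier {g : E n → EReal} {h : E r → EReal} {L : Matrix (Fin r) (Fin n) ℝ}
    (hg : ProperClosedConvex g) (hh : ProperClosedConvex h)
    (h_ri : ∃ x ∈ intrinsicInterior ℝ (dom g), act L x ∈ intrinsicInterior ℝ (dom h))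
    {w : E n} {m : ℝ}
    (hmin : ∀ x (s t : ℝ), g x ≤ s → h (act L x) ≤ t → m + inner ℝ w x ≤ s + t) :
    ∃ u : E r, ∀ x (s : ℝ) y (t : ℝ), g x ≤ s → h y ≤ t →
      m + inner ℝ w x + inner ℝ u (y - act L x) ≤ s + t := by
  obtain ⟨x₀, hx₀, hy₀⟩ := h_ri
  obtain ⟨s₀, hs₀⟩ := hg.exists_coe (intrinsicInterior_subset hx₀)
  obtain ⟨t₀, ht₀⟩ := hh.exists_coe (intrinsicInterior_subset hy₀)
  -- The epigraph of the perturbed objective, and the cone it generates.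
  set C : Set (E r × ℝ) := {p | ∃ x s y t, g x ≤ ((s : ℝ) : EReal) ∧ h y ≤ ((t : ℝ) : EReal) ∧
    p.1 = y - act L x ∧ p.2 = s + t - m - inner ℝ w x}
  have hC : Convex ℝ C := by
    rintro ⟨p, p'⟩ ⟨x, s, y, t, hx, hy, hp, hp'⟩ ⟨q, q'⟩ ⟨x₁, s₁, y₁, t₁, hx₁, hy₁, hq, hq'⟩
      α β hα hβ hαβ
    simp only at hp hp' hq hq'
    subst hp hp' hq hq'
    refine ⟨α • x + β • x₁, α * s + β * s₁, α • y + β • y₁, α * t + β * t₁, ?_, ?_, ?_, ?_⟩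
    · exact hg.convex (x := (x, s)) hx (y := (x₁, s₁)) hx₁ hα hβ hαβ
    · exact hh.convex (x := (y, t)) hy (y := (y₁, t₁)) hy₁ hα hβ hαβ
    · simp only [Prod.fst_add, Prod.smul_fst, act_add, act_smul]
      module
    · simp only [Prod.snd_add, Prod.smul_snd, smul_eq_mul, inner_add_right,
        real_inner_smul_right]
      linear_combination -m * hαβ
  have hC0 : ((0 : E r), s₀ + t₀ - m - inner ℝ w x₀) ∈ C :=
    ⟨x₀, s₀, act L x₀, t₀, hs₀.le, ht₀.le, by simp, rfl⟩
  have hCvert : ∀ t, ((0 : E r), t) ∈ C → 0 ≤ t := by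
    rintro t ⟨x, s, y, t', hx, hy, hp, rfl⟩
    have hyx : y = act L x := (sub_eq_zero.1 hp.symm)
    have := hmin x s t' hx (hyx ▸ hy)
    linarith
  -- The qualification is used here: moving from x₀ away from x and from Lx₀ away from y by the same
  -- factor c changes the residual y - Lx into -c(y - Lx).
  have hCneg : ∀ p ∈ C, ∃ c > (0 : ℝ), ∃ t, (-(c • p.1), t) ∈ C := by
    rintro ⟨p, p'⟩ ⟨x, s, y, t, hx, hy, hp, hp'⟩
    simp only at hp
    obtain ⟨ε₁, hε₁, h₁⟩ := exists_prolongation hx₀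
      (show x ∈ dom g from lt_of_le_of_lt hx (EReal.coe_lt_top s))
    obtain ⟨ε₂, hε₂, h₂⟩ := exists_prolongation hy₀
      (show y ∈ dom h from lt_of_le_of_lt hy (EReal.coe_lt_top t))
    set c := min ε₁ ε₂
    have hc : 0 < c := lt_min hε₁ hε₂
    obtain ⟨s', hs'⟩ := hg.exists_coe (h₁ c ⟨hc.le, min_le_left _ _⟩)
    obtain ⟨t', ht'⟩ := hh.exists_coe (h₂ c ⟨hc.le, min_le_right _ _⟩)
    refine ⟨c, hc, _, _, s', _, t', hs'.le, ht'.le, ?_, rfl⟩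
    simp only [hp, act_sub, act_smul]
    module
  set K : Set (E r × ℝ) := {p | p = 0 ∨ ∃ c > (0 : ℝ), c • p ∈ C}
  have hKC : ∀ p ∈ K, p = 0 ∨ ∃ c > (0 : ℝ), ∃ q ∈ C, p = c • q := by
    rintro p (hp | ⟨c, hc, hcp⟩)
    · exact Or.inl hp
    · exact Or.inr ⟨c⁻¹, inv_pos.2 hc, c • p, hcp, by rw [inv_smul_smul₀ hc.ne']⟩
  have hCK : ∀ c : ℝ, 0 < c → ∀ q ∈ C, c • q ∈ K := fun c hc q hq =>
    Or.inr ⟨c⁻¹, inv_pos.2 hc, by rwa [inv_smul_smul₀ hc.ne']⟩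
  obtain ⟨ℓ, hℓ⟩ := exists_linear_form_of_cone K
    (by
      intro p hp q hq
      rcases hKC p hp with rfl | ⟨a, ha, p', hp', rfl⟩
      · rwa [zero_add]
      rcases hKC q hq with rfl | ⟨b, hb, q', hq', rfl⟩
      · rwa [add_zero]
      have hab : 0 < a + b := add_pos ha hb
      have hmem := hC hp' hq' (div_nonneg ha.le hab.le) (div_nonneg hb.le hab.le)
        (by field_simp)
      have := hCK (a + b) hab _ hmem
      rwa [smul_add, smul_smul, smul_smul, mul_div_cancel₀ _ hab.ne',
        mul_div_cancel₀ _ hab.ne'] at this)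
    (by
      intro c hc p hp
      rcases hKC p hp with rfl | ⟨a, ha, p', hp', rfl⟩
      · rw [smul_zero]; exact Or.inl rfl
      · rw [smul_smul]; exact hCK _ (mul_pos hc ha) _ hp')
    (Or.inl rfl)
    (by
      intro p hp
      rcases hKC p hp with rfl | ⟨a, ha, p', hp', rfl⟩
      · exact ⟨0, Or.inl (by simp)⟩
      · obtain ⟨c, hc, t, ht⟩ := hCneg p' hp'
        refine ⟨(a / c) • t, ?_⟩
        have := hCK (a / c) (div_pos ha hc) _ ht
        rwa [Prod.smul_mk, smul_neg, smul_smul, div_mul_cancel₀ _ hc.ne'] at this)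
    (by
      intro t ht
      rcases ht with h0 | ⟨c, hc, hct⟩
      · exact (Prod.mk.inj h0).2.ge
      · have : 0 ≤ c * t := hCvert _ (by simpa using hct)
        exact nonneg_of_mul_nonneg_right this hc)
  set u : E r := (InnerProductSpace.toDual ℝ (E r)).symm (LinearMap.toContinuousLinearMap ℓ)
  have hu : ∀ y, inner ℝ u y = ℓ y := fun y => by
    simp [u, InnerProductSpace.toDual_symm_apply]
  refine ⟨u, fun x s y t hx hy => ?_⟩
  have h1 := hℓ ((1 : ℝ) • (y - act L x, s + t - m - inner ℝ w x))
    (hCK 1 one_pos _ ⟨x, s, y, t, hx, hy, rfl, rfl⟩)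
  rw [one_smul, ← hu] at h1
  simp only at h1
  linarith

/-- The Karush-Kuhn-Tucker system of the primal-dual pair `(u, x)`. -/
def IsKKT (f : E n → ℝ) (g : E n → EReal) (h : E r → EReal) (L : Matrix (Fin r) (Fin n) ℝ)
    (z : E r × E n) : Prop :=
  (∃ a, HasSubgradient g a (-(gradient f z.2 + act L.transpose z.1)) z.2) ∧
    ∃ b, HasSubgradient h b z.1 (act L z.2)

/-- Every point (x, f(x)) minimizes s - f(y) over the epigraph of f, so the optimality condition
with ψ = -f is the gradient inequality. -/
theorem add_inner_gradient_le {f : E n → ℝ} (hf : ConvexOn ℝ Set.univ f)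
    (hd : Differentiable ℝ f) (x y : E n) : f x + inner ℝ (gradient f x) (y - x) ≤ f y := by
  have hC : Convex ℝ {p : E n × ℝ | f p.1 ≤ p.2} := by
    simpa using hf.convex_epigraph
  have := add_inner_le_of_isMin hC (x := x) (a := f x) (ψ := fun y => -f y)
    (d := -gradient f x) (by simp) (by
      rw [hasGradientAt_iff_hasFDerivAt, map_neg]
      exact (hd x).hasGradientAt.hasFDerivAt.neg)
    (fun y s (hs : f y ≤ s) => by linarith) (y := y) (s := f y) (by simp)
  rwa [neg_neg] at this

theorem hasGradientAt_add_inner {f : E n → ℝ} (hd : Differentiable ℝ f) (w x : E n) :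
    HasGradientAt (fun y => f y + inner ℝ w y) (gradient f x + w) x := by
  rw [hasGradientAt_iff_hasFDerivAt, map_add]
  exact (hd x).hasGradientAt.hasFDerivAt.add
    ((InnerProductSpace.toDual ℝ (E n) w).hasFDerivAt)

/-- First-order optimality linearizes f at x, and `exists_multiplier` decouples y from Lx. Freezing
one of the two variables at its optimal value gives each subgradient inequality. -/
theorem exists_isKKT {f : E n → ℝ} {g : E n → EReal} {h : E r → EReal}
    {L : Matrix (Fin r) (Fin n) ℝ} (hg : ProperClosedConvex g) (hh : ProperClosedConvex h)
    (hd : Differentiable ℝ f)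
    (h_ri : ∃ x ∈ intrinsicInterior ℝ (dom g), act L x ∈ intrinsicInterior ℝ (dom h))
    {x : E n} (hx : x ∈ argmin (primalObj f g h L)) : ∃ u, IsKKT f g h L (u, x) := by
  obtain ⟨hdom, hmin⟩ := hx
  have hfg : ∀ x, (f x : EReal) + g x ≠ ⊥ := fun x =>
    EReal.add_ne_bot_iff.2 ⟨EReal.coe_ne_bot _, hg.ne_bot x⟩
  have hgx : x ∈ dom g := by
    by_contra hnot
    have h1 : g x = ⊤ := by simpa [dom] using hnot
    have h2 : (f x : EReal) + g x + h (act L x) < ⊤ := hdom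
    rw [h1, EReal.add_top_of_ne_bot (EReal.coe_ne_bot _),
      EReal.top_add_of_ne_bot (hh.ne_bot _)] at h2
    exact lt_irrefl _ h2
  have hhx : act L x ∈ dom h := by
    by_contra hnot
    have h1 : h (act L x) = ⊤ := by simpa [dom] using hnot
    have h2 : (f x : EReal) + g x + h (act L x) < ⊤ := hdom
    rw [h1, EReal.add_top_of_ne_bot (hfg x)] at h2
    exact lt_irrefl _ h2
  obtain ⟨a, ha⟩ := hg.exists_coe hgx
  obtain ⟨b, hb⟩ := hh.exists_coe hhx
  set C : Set (E n × ℝ) := {p | ∃ s t : ℝ, g p.1 ≤ s ∧ h (act L p.1) ≤ t ∧ p.2 = s + t}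
  have hC : Convex ℝ C := by
    rintro ⟨p, p'⟩ ⟨s, t, hs, ht, hp'⟩ ⟨q, q'⟩ ⟨s₁, t₁, hs₁, ht₁, hq'⟩ α β hα hβ hαβ
    simp only at hs ht hp' hs₁ ht₁ hq'
    subst hp' hq'
    refine ⟨α * s + β * s₁, α * t + β * t₁, ?_, ?_, ?_⟩
    · exact hg.convex (x := (p, s)) hs (y := (q, s₁)) hs₁ hα hβ hαβ
    · have := hh.convex (x := (act L p, t)) ht (y := (act L q, t₁)) ht₁ hα hβ hαβ
      simpa [act_add, act_smul] using this
    · simp; ring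
  have hlin : ∀ y (s t : ℝ), g y ≤ s → h (act L y) ≤ t →
      a + b + inner ℝ (-gradient f x) (y - x) ≤ s + t := by
    intro y s t hs ht
    refine add_inner_le_of_isMin hC (x := x) (a := a + b) ⟨a, b, ha.le, hb.le, rfl⟩
      (hd x).hasGradientAt ?_ ⟨s, t, hs, ht, rfl⟩
    rintro y s' ⟨s, t, hs, ht, hs'⟩
    simp only at hs ht hs'
    have h1 : (f x : EReal) + g x + h (act L x) ≤ (f y : EReal) + g y + h (act L y) := hmin y
    have h2 : (f y : EReal) + g y + h (act L y) ≤ f y + s + t := by gcongr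
    have h3 := h1.trans h2
    rw [ha, hb] at h3
    have h4 : f x + a + b ≤ f y + s + t := by exact_mod_cast h3
    rw [hs']
    linarith
  obtain ⟨u, hu⟩ := exists_multiplier hg hh h_ri (w := -gradient f x)
    (m := a + b - inner ℝ (-gradient f x) x) (fun y s t hs ht => by
      have := hlin y s t hs ht
      rw [inner_sub_right] at this
      linarith)
  refine ⟨u, ⟨a, ha, fun y s hs => ?_⟩, b, hb, fun y t ht => ?_⟩
  · have h1 := hu y s (act L x) b hs hb.le
    have h2 : inner ℝ (act L.transpose u) (y - x) = inner ℝ u (act L y - act L x) := by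
      rw [inner_act_left, Matrix.transpose_transpose, act_sub]
    simp only [neg_add_rev, inner_add_left, inner_neg_left, h2]
    simp only [inner_sub_right, inner_neg_left] at h1 ⊢
    linarith
  · have h1 := hu x a y t ha.le ht
    linarith

theorem conj_add_eq_of_hasSubgradient {f : E n → ℝ} {g : E n → EReal} {L : Matrix (Fin r) (Fin n) ℝ}
    (hf : ConvexOn ℝ Set.univ f) (hd : Differentiable ℝ f) (hg : ProperClosedConvex g)
    {u : E r} {x : E n} {a : ℝ}
    (ha : HasSubgradient g a (-(gradient f x + act L.transpose u)) x) :
    conj (fun x => g x + (f x : EReal)) (-act L.transpose u) =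
      ((inner ℝ (-act L.transpose u) x - (a + f x) : ℝ) : EReal) := by
  have hb : ∀ y, g y + (f y : EReal) ≠ ⊥ := fun y =>
    EReal.add_ne_bot_iff.2 ⟨hg.ne_bot y, EReal.coe_ne_bot _⟩
  refine HasSubgradient.conj_eq hb ⟨by simp only [ha.1]; norm_cast, fun y s hs => ?_⟩
  have hgy : g y ≤ ((s - f y : ℝ) : EReal) := by
    rw [EReal.coe_sub]
    exact EReal.le_sub_iff_add_le (by simp) (by simp) |>.2 hs
  have h1 := ha.2 y _ hgy
  have h2 := add_inner_gradient_le hf hd x y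
  simp only [neg_add_rev, inner_add_left, inner_neg_left] at h1 ⊢
  linarith

theorem dual_value_eq (L : Matrix (Fin r) (Fin n) ℝ) (u : E r) (x : E n) (a b c : ℝ) :
    (inner ℝ (-act L.transpose u) x - (a + c)) + (inner ℝ u (act L x) - b) = -(c + a + b) := by
  rw [inner_neg_left, ← inner_act_right]; ring

theorem isKKT_iff_mem_solutions {f : E n → ℝ} {g : E n → EReal} {h : E r → EReal}
    {L : Matrix (Fin r) (Fin n) ℝ} (hg : ProperClosedConvex g) (hh : ProperClosedConvex h)
    (hf : ConvexOn ℝ Set.univ f) (hd : Differentiable ℝ f)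
    (h_ri : ∃ x ∈ intrinsicInterior ℝ (dom g), act L x ∈ intrinsicInterior ℝ (dom h))
    (z : E r × E n) : IsKKT f g h L z ↔ z ∈ solutions f g h L := by
  obtain ⟨u, x⟩ := z
  have hdual : ∀ {u x a b}, HasSubgradient g a (-(gradient f x + act L.transpose u)) x →
      HasSubgradient h b u (act L x) →
      dualObj f g h L u = ((-(f x + a + b) : ℝ) : EReal) := by
    intro u x a b ha hb
    rw [dualObj, conj_add_eq_of_hasSubgradient hf hd hg ha, hb.conj_eq hh.ne_bot, ← EReal.coe_add, dual_value_eq]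
  have hlow : ∀ {x a b}, g x = ((a : ℝ) : EReal) → h (act L x) = ((b : ℝ) : EReal) → ∀ u,
      ((inner ℝ (-act L.transpose u) x - (a + f x) : ℝ) : EReal) ≤
        conj (fun x => g x + (f x : EReal)) (-act L.transpose u) ∧
      ((inner ℝ u (act L x) - b : ℝ) : EReal) ≤ conj h u := by
    intro x a b ha hb u
    exact ⟨coe_le_conj (by rw [ha]; norm_cast), coe_le_conj hb⟩
  constructor
  · rintro ⟨⟨a, ha⟩, b, hb⟩
    simp only at ha hb
    refine ⟨⟨?_, fun u' => ?_⟩, ?_, fun y => ?_⟩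
    · change dualObj f g h L u < ⊤
      rw [hdual ha hb]; exact EReal.coe_lt_top _
    · simp only
      obtain ⟨h1, h2⟩ := hlow ha.1 hb.1 u'
      rw [hdual ha hb, ← dual_value_eq L u' x a b (f x), EReal.coe_add]
      exact add_le_add h1 h2
    · change (f x : EReal) + g x + h (act L x) < ⊤
      rw [ha.1, hb.1]; exact EReal.coe_lt_top (f x + a + b)
    · change (f x : EReal) + g x + h (act L x) ≤ (f y : EReal) + g y + h (act L y)
      rw [ha.1, hb.1, add_assoc (f y : EReal)]
      have h1 : ((f x - f y + a + b : ℝ) : EReal) ≤ g y + h (act L y) := by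
        refine coe_le_add_of_forall (hg.ne_bot y) (hh.ne_bot _) fun s t hs ht => ?_
        have e1 := ha.2 y s hs
        have e2 := hb.2 (act L y) t ht
        have e3 := add_inner_gradient_le hf hd x y
        rw [neg_add_rev, inner_add_left, inner_neg_left, inner_neg_left, ← inner_act_right,
          act_sub] at e1
        linarith
      have h2 := add_le_add_right h1 (f y : EReal)
      refine le_trans (le_of_eq ?_) h2
      norm_cast
      ring
  · rintro ⟨⟨hudom, humin⟩, hx⟩
    simp only at hudom humin hx
    obtain ⟨u₀, ⟨a, ha⟩, b, hb⟩ := exists_isKKT hg hh hd h_ri hx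
    simp only at ha hb
    -- The dual value at u is at most that at u₀, which is minus the primal value. Fenchel-Young at
    -- x bounds the two conjugates below by numbers with exactly this sum, so both bounds are
    -- attained.
    have h1 := humin u₀
    rw [hdual ha hb, ← dual_value_eq L u x a b (f x)] at h1
    obtain ⟨h2, h3⟩ := hlow ha.1 hb.1 u
    obtain ⟨h4, h5⟩ := le_of_add_le_coe h2 h3 h1
    rw [conj_le_coe_iff fun y => EReal.add_ne_bot_iff.2 ⟨hg.ne_bot y, EReal.coe_ne_bot _⟩] at h4
    rw [conj_le_coe_iff hh.ne_bot] at h5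
    refine ⟨⟨a, ha.1, fun y s hs => ?_⟩, b, hb.1, fun y t ht => ?_⟩
    -- Equality in the first term says that x minimizes g + f + ⟨Lᵀu, ·⟩.
    · refine add_inner_le_of_isMin hg.convex ha.1.le
        (hasGradientAt_add_inner hd (act L.transpose u) x) (fun y s hs => ?_) hs
      have hs' : g y ≤ (s : EReal) := hs
      have e := h4 y (s + f y) (by rw [EReal.coe_add]; exact add_le_add_left hs' _)
      simp only [inner_neg_left] at e
      linarith
    · have e := h5 y t ht
      simp only [inner_sub_right]
      linarith

end Duality

/-! ### Smoothness of f in the metric of Q -/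

section Descent

variable {n : ℕ}

/-- The descent lemma in the metric of `Q`. -/
theorem le_add_inner_gradient_add {f : E n → ℝ} (hd : Differentiable ℝ f)
    {Q : Matrix (Fin n) (Fin n) ℝ} (hQ : Q.PosDef) {β : ℝ}
    (hf_lip : ∀ x y, wnorm Q⁻¹ (gradient f x - gradient f y) ≤ β * wnorm Q (x - y)) (x v : E n) :
    f (x + v) ≤ f x + inner ℝ (gradient f x) v + β / 2 * inner ℝ v (act Q v) := by
  set q := inner ℝ v (act Q v)
  -- The claim is ψ(1) ≤ ψ(0); weighted Cauchy-Schwarz and the Lipschitz bound make the derivative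
  -- nonpositive.
  set ψ : ℝ → ℝ := fun t => f (x + t • v) - t * inner ℝ (gradient f x) v - β / 2 * t ^ 2 * q
  have hψ : ∀ t, HasDerivAt ψ
      (inner ℝ (gradient f (x + t • v)) v - inner ℝ (gradient f x) v - β * t * q) t := by
    intro t
    have hline : HasDerivAt (fun t : ℝ => x + t • v) v t := by
      simpa using ((hasDerivAt_id t).smul_const v).const_add x
    have h1 := (hd (x + t • v)).hasGradientAt.hasFDerivAt.comp_hasDerivAt t hline
    have h2 := (hasDerivAt_id t).mul_const (inner ℝ (gradient f x) v)
    have h3 := (((hasDerivAt_id t).pow 2).const_mul (β / 2)).mul_const q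
    refine ((h1.sub h2).sub h3).congr_deriv ?_
    simp only [InnerProductSpace.toDual_apply_apply, id]
    ring
  have hanti : AntitoneOn ψ (Set.Icc 0 1) := by
    refine antitoneOn_of_deriv_nonpos (convex_Icc 0 1)
      (fun t _ => (hψ t).continuousAt.continuousWithinAt)
      (fun t _ => (hψ t).differentiableAt.differentiableWithinAt) fun t ht => ?_
    rw [interior_Icc] at ht
    rw [(hψ t).deriv]
    have h1 := inner_le_wnorm_mul_wnorm hQ (gradient f (x + t • v) - gradient f x) v
    have h2 := hf_lip (x + t • v) x
    have h3 : wnorm Q (x + t • v - x) = t * wnorm Q v := by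
      have hx : x + t • v - x = t • v := by abel
      rw [hx, wnorm, act_smul, real_inner_smul_left, real_inner_smul_right, ← mul_assoc,
        Real.sqrt_mul (mul_self_nonneg t), Real.sqrt_mul_self ht.1.le, wnorm]
    rw [h3] at h2
    have h4 := mul_le_mul_of_nonneg_right h2 (show 0 ≤ wnorm Q v from Real.sqrt_nonneg _)
    have h5 : wnorm Q v ^ 2 = q := wnorm_sq hQ v
    rw [inner_sub_left] at h1
    have h6 : β * (t * wnorm Q v) * wnorm Q v = β * t * q := by rw [← h5]; ring
    linarith
  have := hanti (Set.left_mem_Icc.2 zero_le_one) (Set.right_mem_Icc.2 zero_le_one) zero_le_one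
  simp only [ψ, zero_smul, add_zero, one_smul] at this
  linarith

/-- A three-point form of the cocoercivity of the gradient. -/
theorem inner_gradient_sub_le {f : E n → ℝ} (hf : ConvexOn ℝ Set.univ f)
    (hd : Differentiable ℝ f) {Q : Matrix (Fin n) (Fin n) ℝ} (hQ : Q.PosDef) {β : ℝ}
    (hf_lip : ∀ x y, wnorm Q⁻¹ (gradient f x - gradient f y) ≤ β * wnorm Q (x - y))
    (x x' y : E n) :
    inner ℝ (gradient f x - gradient f y) (y - x') ≤
      β / 4 * inner ℝ (x' - x) (act Q (x' - x)) := by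
  -- Half steps balance the bound: the descent lemma from x to x + e and from y to y - e, combined
  -- with the gradient inequalities at y and x for these endpoints, costs β⟨e, Qe⟩, a quarter of the
  -- form at x' - x = 2e.
  set e := (1 / 2 : ℝ) • (x' - x)
  have hx' : x' = x + e + e := by
    simp only [e]; module
  have h1 := le_add_inner_gradient_add hd hQ hf_lip x e
  have h2 := le_add_inner_gradient_add hd hQ hf_lip y (-e)
  have h3 := add_inner_gradient_le hf hd y (x + e)
  have h4 := add_inner_gradient_le hf hd x (y + -e)
  have h5 : x' - x = (2 : ℝ) • e := by
    rw [hx']; module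
  rw [h5, act_smul, real_inner_smul_left, real_inner_smul_right, hx']
  simp only [act_neg, inner_neg_left, inner_neg_right, neg_neg, inner_sub_left, inner_sub_right,
    inner_add_right] at h1 h2 h3 h4 ⊢
  linarith

theorem continuous_gradient {f : E n → ℝ} (hf : ContDiff ℝ 1 f) : Continuous (gradient f) :=
  (InnerProductSpace.toDual ℝ (E n)).symm.continuous.comp (hf.continuous_fderiv one_ne_zero)

end Descent

/-! ### The TriPD step and its Fejér inequality -/

section Algorithm

variable {r n : ℕ} {f : E n → ℝ} {g : E n → EReal} {h : E r → EReal}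
  {L : Matrix (Fin r) (Fin n) ℝ} {Sig : Matrix (Fin r) (Fin r) ℝ}
  {Gam Q : Matrix (Fin n) (Fin n) ℝ} {β : ℝ}

theorem posDef_matS (hSig : Sig.PosDef) (hGam : Gam.PosDef) : (matS Sig Gam).PosDef := by
  have := posDef_fromBlocks (B := 0) hSig.inv (D := Gam⁻¹) (by simpa using hGam.inv)
  simpa [matS] using this

theorem two_smul_matPtilde_sub_matS :
    (2 : ℝ) • matPtilde L Sig Gam Q β - matS Sig Gam =
      Matrix.fromBlocks Sig⁻¹ (-L) (-L).transpose (Gam⁻¹ - (β / 2) • Q) := by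
  ext i j
  cases i <;> cases j <;> simp [matPtilde, matS] <;> ring

/-- Eliminating the block Sig⁻¹ leaves exactly the stepsize matrix as Schur complement. -/
theorem posDef_two_smul_matPtilde_sub_matS (hSig : Sig.PosDef)
    (h_step : (Gam⁻¹ - (β / 2) • Q - L.transpose * Sig * L).PosDef) :
    ((2 : ℝ) • matPtilde L Sig Gam Q β - matS Sig Gam).PosDef := by
  rw [two_smul_matPtilde_sub_matS]
  refine posDef_fromBlocks hSig.inv ?_
  rw [Matrix.nonsing_inv_nonsing_inv _ ((Matrix.isUnit_iff_isUnit_det _).1 hSig.isUnit)]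
  simpa using h_step

theorem blockNorm_matS_sq (hSig : Sig.PosDef) (hGam : Gam.PosDef) (w : E r × E n) :
    blockNorm (matS Sig Gam) w ^ 2 =
      inner ℝ w.1 (act Sig⁻¹ w.1) + inner ℝ w.2 (act Gam⁻¹ w.2) := by
  rw [blockNorm_sq (posDef_matS hSig hGam), matS, inner_stack_fromBlocks]
  simp [act]

theorem blockNorm_two_smul_matPtilde_sub_matS_sq (hSig : Sig.PosDef)
    (h_step : (Gam⁻¹ - (β / 2) • Q - L.transpose * Sig * L).PosDef) (w : E r × E n) :
    blockNorm ((2 : ℝ) • matPtilde L Sig Gam Q β - matS Sig Gam) w ^ 2 =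
      inner ℝ w.1 (act Sig⁻¹ w.1) + inner ℝ w.2 (act Gam⁻¹ w.2) - 2 * inner ℝ w.1 (act L w.2)
        - β / 2 * inner ℝ w.2 (act Q w.2) := by
  rw [blockNorm_sq (posDef_two_smul_matPtilde_sub_matS hSig h_step),
    two_smul_matPtilde_sub_matS, inner_stack_fromBlocks]
  have hneg : ∀ y : E n, act (-L) y = -act L y := fun y => by
    ext i; simp [act, Matrix.neg_mulVec]
  rw [inner_act_right (-L).transpose, Matrix.transpose_transpose, sub_act, smul_act, hneg,
    inner_sub_right, inner_neg_right, inner_neg_left, real_inner_smul_right,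
    real_inner_comm w.1 (act L w.2)]
  ring

theorem exists_pos_mul_norm_sq_le_blockNorm_sq {W : Matrix (Fin r ⊕ Fin n) (Fin r ⊕ Fin n) ℝ}
    (hW : W.PosDef) : ∃ c > 0, ∀ w : E r × E n, c * ‖w‖ ^ 2 ≤ blockNorm W w ^ 2 := by
  obtain ⟨c, hc, h⟩ := exists_pos_mul_norm_sq_le hW
  refine ⟨c, hc, fun w => ?_⟩
  rw [blockNorm_sq hW]
  refine le_trans ?_ (h (stack w))
  rw [norm_stack_sq]
  gcongr
  rcases max_choice ‖w.1‖ ‖w.2‖ with h | h <;> rw [Prod.norm_def, h] <;>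
    nlinarith [sq_nonneg ‖w.1‖, sq_nonneg ‖w.2‖]

/-- The optimality conditions of the two proximal steps of TriPD. -/
theorem step_spec (hg : ProperClosedConvex g) (hh : ProperClosedConvex h) (hSig : Sig.PosDef)
    (hGam : Gam.PosDef) {z z' : E r × E n} (hz : z' = step f g h L Sig Gam z) :
    (∃ b, HasSubgradient (conj h) b
      (act Sig⁻¹ (z.1 - (z'.1 - act Sig (act L (z'.2 - z.2)))) + act L z.2)
      (z'.1 - act Sig (act L (z'.2 - z.2)))) ∧
    ∃ a, HasSubgradient g a
      (act Gam⁻¹ (z.2 - z'.2) - gradient f z.2 -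
        act L.transpose (z'.1 - act Sig (act L (z'.2 - z.2)))) z'.2 := by
  set ubar : E r := prox Sig⁻¹ (conj h) (z.1 + act Sig (act L z.2)) with hub
  set y : E n := z.2 - act Gam (gradient f z.2) - act Gam (act L.transpose ubar) with hy
  have h2 : z'.2 = prox Gam⁻¹ g y := by rw [hz]; rfl
  have h1 : z'.1 = ubar + act Sig (act L (z'.2 - z.2)) := by rw [h2, hz]; rfl
  have h3 : z'.1 - act Sig (act L (z'.2 - z.2)) = ubar := by rw [h1]; abel
  obtain ⟨b, hb⟩ := prox_hasSubgradient hh.conj hSig.inv (z.1 + act Sig (act L z.2))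
  obtain ⟨a, ha⟩ := prox_hasSubgradient hg hGam.inv y
  rw [← hub] at hb
  rw [← h2] at ha
  rw [h3]
  refine ⟨⟨b, ?_⟩, a, ?_⟩
  · convert hb using 1
    rw [add_sub_right_comm, act_add, act_inv_act hSig]
  · convert ha using 1
    simp only [hy, act_sub, act_inv_act hGam]
    abel

/-- Fejér monotonicity of TriPD with respect to the KKT points. -/
theorem IsKKT.blockNorm_step_le (hg : ProperClosedConvex g) (hh : ProperClosedConvex h)
    (hf : ConvexOn ℝ Set.univ f) (hd : Differentiable ℝ f) (hQ : Q.PosDef)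
    (hf_lip : ∀ x y, wnorm Q⁻¹ (gradient f x - gradient f y) ≤ β * wnorm Q (x - y))
    (hSig : Sig.PosDef) (hGam : Gam.PosDef)
    (h_step : (Gam⁻¹ - (β / 2) • Q - L.transpose * Sig * L).PosDef)
    {s : E r × E n} (hs : IsKKT f g h L s) {z z' : E r × E n}
    (hz : z' = step f g h L Sig Gam z) :
    blockNorm (matS Sig Gam) (z' - s) ^ 2 ≤ blockNorm (matS Sig Gam) (z - s) ^ 2 -
      blockNorm ((2 : ℝ) • matPtilde L Sig Gam Q β - matS Sig Gam) (z' - z) ^ 2 := by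
  obtain ⟨⟨a, ha⟩, b, hb⟩ := hs
  obtain ⟨⟨b', hb'⟩, a', ha'⟩ := step_spec hg hh hSig hGam hz
  have m1 := hb'.monotone (hb.conj hh.ne_bot)
  have m2 := ha'.monotone ha
  have m3 := inner_gradient_sub_le hf hd hQ hf_lip z.2 z'.2 s.2
  rw [blockNorm_matS_sq hSig hGam, blockNorm_matS_sq hSig hGam,
    blockNorm_two_smul_matPtilde_sub_matS_sq hSig h_step]
  obtain ⟨u, x⟩ := z
  obtain ⟨u', x'⟩ := z'
  obtain ⟨us, xs⟩ := s
  clear hz ha hb ha' hb' hf_lip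
  simp only [Prod.fst_sub, Prod.snd_sub] at *
  -- New unknowns: (p, q) is the new error z' - s, and (δ, η) is the step z' - z.
  obtain ⟨p, rfl⟩ : ∃ p, u' = us + p := ⟨u' - us, by abel⟩
  obtain ⟨δ, rfl⟩ : ∃ δ, u = us + p - δ := ⟨us + p - u, by abel⟩
  obtain ⟨q, rfl⟩ : ∃ q, x' = xs + q := ⟨x' - xs, by abel⟩
  obtain ⟨η, rfl⟩ : ∃ η, x = xs + q - η := ⟨xs + q - x, by abel⟩
  have e1 : xs + q - (xs + q - η) = η := by abel
  have e2 : us + p - (us + p - δ) = δ := by abel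
  have e3 : xs - (xs + q) = -q := by abel
  have e4 : xs + q - xs = q := by abel
  have e5 : us + p - us = p := by abel
  have e6 : us + p - δ - us = p - δ := by abel
  have e7 : xs + q - η - xs = q - η := by abel
  have e8 : xs + q - η - (xs + q) = -η := by abel
  have e9 : us + p - δ - (us + p - act Sig (act L η)) = act Sig (act L η) - δ := by abel
  have e10 : us + p - act Sig (act L η) - us = p - act Sig (act L η) := by abel
  rw [e1, e9, act_sub, act_inv_act hSig, e10] at m1
  rw [e1, e4, e8] at m2
  rw [e3, e1] at m3
  rw [e1, e2, e4, e5, e6, e7]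
  have s1 : inner ℝ δ (act Sig⁻¹ p) = inner ℝ p (act Sig⁻¹ δ) := inner_act_comm hSig.inv _ _
  have s2 : inner ℝ η (act Gam⁻¹ q) = inner ℝ q (act Gam⁻¹ η) := inner_act_comm hGam.inv _ _
  have s3 : inner ℝ (act Sig⁻¹ δ) (act Sig (act L η)) = inner ℝ δ (act L η) := by
    rw [inner_act_left, transpose_eq_of_posDef hSig.inv, act_inv_act hSig]
  have s4 : inner ℝ (act Sig⁻¹ δ) p = inner ℝ p (act Sig⁻¹ δ) := real_inner_comm _ _
  have s5 : inner ℝ (act Gam⁻¹ η) q = inner ℝ q (act Gam⁻¹ η) := real_inner_comm _ _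
  have m1' : 0 ≤ inner ℝ (act L q - act Sig⁻¹ δ) (p - act Sig (act L η)) := by
    convert m1 using 2
    rw [act_sub, act_add]
    abel
  have m2' : 0 ≤ -inner ℝ (act Gam⁻¹ η) q -
      inner ℝ (gradient f (xs + q - η) - gradient f xs) q -
      inner ℝ (p - act Sig (act L η)) (act L q) := by
    convert m2 using 1
    rw [inner_act_right, real_inner_comm, real_inner_comm, ← inner_neg_left, ← inner_sub_left,
      ← inner_sub_left]
    congr 1
    simp only [act_neg, act_add, act_sub]
    abel
  rw [inner_neg_right] at m3
  -- By symmetry the coupling terms of `m1'` and `m2'` agree up to sign and cancel in the sum; ⟨δ,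
  -- Lη⟩ survives from the correction of the dual step.
  have s6 : inner ℝ (act L q) (p - act Sig (act L η)) =
      inner ℝ (p - act Sig (act L η)) (act L q) := real_inner_comm _ _
  rw [inner_sub_left, s6, inner_sub_right (act Sig⁻¹ δ), s3, s4] at m1'
  rw [s5] at m2'
  simp only [act_sub, inner_sub_left, inner_sub_right, s1, s2] at *
  linarith

theorem continuous_blockNorm (W : Matrix (Fin r ⊕ Fin n) (Fin r ⊕ Fin n) ℝ) :
    Continuous (blockNorm W : E r × E n → ℝ) := by
  have hstack : Continuous (stack : E r × E n → EuclideanSpace ℝ (Fin r ⊕ Fin n)) := by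
    refine (PiLp.continuous_toLp 2 _).comp (continuous_pi fun i => ?_)
    cases i <;> simp only [Sum.elim_inl, Sum.elim_inr] <;> fun_prop
  have hmul : Continuous fun y : EuclideanSpace ℝ (Fin r ⊕ Fin n) =>
      √(inner ℝ y (WithLp.toLp 2 (W.mulVec y.ofLp))) := by fun_prop
  exact hmul.comp hstack

theorem exists_tendsto_of_nonneg_of_le {d ρ : ℕ → ℝ} (hd : ∀ k, 0 ≤ d k) (hρ : ∀ k, 0 ≤ ρ k)
    (h : ∀ k, d (k + 1) ≤ d k - ρ k) :
    Antitone d ∧ (∃ l, Tendsto d atTop (𝓝 l)) ∧ Tendsto ρ atTop (𝓝 0) := by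
  have hanti : Antitone d := antitone_nat_of_succ_le fun k => by linarith [h k, hρ k]
  have hlim : Tendsto d atTop (𝓝 (⨅ k, d k)) :=
    tendsto_atTop_ciInf hanti ⟨0, by rintro _ ⟨k, rfl⟩; exact hd k⟩
  refine ⟨hanti, ⟨_, hlim⟩, ?_⟩
  have h2 := hlim.sub (hlim.comp (tendsto_add_atTop_nat 1))
  rw [sub_self] at h2
  exact squeeze_zero hρ (fun k => by simpa using by linarith [h k]) h2

theorem tendsto_zero_of_mul_norm_sq_le {F : Type*} [NormedAddCommGroup F] {w : ℕ → F}
    {ρ : ℕ → ℝ} {c : ℝ} (hc : 0 < c) (h : ∀ k, c * ‖w k‖ ^ 2 ≤ ρ k)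
    (hρ : Tendsto ρ atTop (𝓝 0)) : Tendsto w atTop (𝓝 0) := by
  rw [tendsto_zero_iff_norm_tendsto_zero]
  have h1 : Tendsto (fun k => ‖w k‖ ^ 2) atTop (𝓝 0) := by
    refine squeeze_zero (fun k => sq_nonneg _) (g := fun k => ρ k / c) (fun k => ?_) ?_
    · rw [le_div_iff₀ hc, mul_comm]; exact h k
    · simpa using hρ.div_const c
  have h2 := (Real.continuous_sqrt.tendsto 0).comp h1
  simpa [Function.comp_def, Real.sqrt_sq (norm_nonneg _)] using h2

end Algorithm

end TriPD

/-! ### Convergence of the iterates -/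

theorem mainTheorem1 (r n : ℕ)
    (f : TriPD.E n → ℝ) (g : TriPD.E n → EReal) (h : TriPD.E r → EReal)
    (L : Matrix (Fin r) (Fin n) ℝ)
    (hg : TriPD.ProperClosedConvex g) (hh : TriPD.ProperClosedConvex h)
    (hf_convex : ConvexOn ℝ Set.univ f) (hf_smooth : ContDiff ℝ 1 f)
    (Q : Matrix (Fin n) (Fin n) ℝ) (hQ : Q.PosDef)
    (β : ℝ) (hβ : 0 ≤ β)
    (hf_lip : ∀ x y : TriPD.E n,
      TriPD.wnorm Q⁻¹ (gradient f x - gradient f y) ≤ β * TriPD.wnorm Q (x - y))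
    (h_sol : (TriPD.argmin (TriPD.primalObj f g h L)).Nonempty)
    (h_ri : ∃ x ∈ intrinsicInterior ℝ (TriPD.dom g),
      TriPD.act L x ∈ intrinsicInterior ℝ (TriPD.dom h))
    (Sig : Matrix (Fin r) (Fin r) ℝ) (hSig : Sig.PosDef)
    (Gam : Matrix (Fin n) (Fin n) ℝ) (hGam : Gam.PosDef)
    (h_step : (Gam⁻¹ - (β / 2) • Q - L.transpose * Sig * L).PosDef)
    (z : ℕ → TriPD.E r × TriPD.E n)
    (hz : ∀ k, z (k + 1) = TriPD.step f g h L Sig Gam (z k)) :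
    (TriPD.matS Sig Gam).PosDef ∧
    ((2 : ℝ) • TriPD.matPtilde L Sig Gam Q β - TriPD.matS Sig Gam).PosDef ∧
    (∀ zstar ∈ TriPD.solutions f g h L, ∀ k,
      TriPD.blockNorm (TriPD.matS Sig Gam) (z (k + 1) - zstar) ^ 2 ≤
        TriPD.blockNorm (TriPD.matS Sig Gam) (z k - zstar) ^ 2 -
          TriPD.blockNorm ((2 : ℝ) • TriPD.matPtilde L Sig Gam Q β - TriPD.matS Sig Gam)
            (z (k + 1) - z k) ^ 2) ∧
    ∃ zstar ∈ TriPD.solutions f g h L, Tendsto z atTop (𝓝 zstar) := by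
  open TriPD in
  have hd : Differentiable ℝ f := hf_smooth.differentiable one_ne_zero
  have hS := posDef_matS hSig hGam
  have hW := posDef_two_smul_matPtilde_sub_matS (Gam := Gam) (Q := Q) (β := β) hSig h_step
  have hKKT := isKKT_iff_mem_solutions hg hh hf_convex hd h_ri
  have hfejer : ∀ s, IsKKT f g h L s → ∀ k,
      blockNorm (matS Sig Gam) (z (k + 1) - s) ^ 2 ≤ blockNorm (matS Sig Gam) (z k - s) ^ 2 -
        blockNorm ((2 : ℝ) • matPtilde L Sig Gam Q β - matS Sig Gam) (z (k + 1) - z k) ^ 2 :=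
    fun s hs k => hs.blockNorm_step_le hg hh hf_convex hd hQ hf_lip hSig hGam h_step (hz k)
  refine ⟨hS, hW, fun s hs k => hfejer s ((hKKT s).2 hs) k, ?_⟩
  obtain ⟨cS, hcS, hS_le⟩ := exists_pos_mul_norm_sq_le_blockNorm_sq hS
  obtain ⟨cW, hcW, hW_le⟩ := exists_pos_mul_norm_sq_le_blockNorm_sq hW
  have hlim := fun s hs => exists_tendsto_of_nonneg_of_le
    (fun k => sq_nonneg (blockNorm (matS Sig Gam) (z k - s))) (fun k => sq_nonneg _) (hfejer s hs)
  obtain ⟨x₀, hx₀⟩ := h_sol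
  obtain ⟨u₀, hs₀⟩ := exists_isKKT hg hh hd h_ri hx₀
  obtain ⟨hanti, -, hres⟩ := hlim _ hs₀
  have hdiff : Tendsto (fun k => z (k + 1) - z k) atTop (𝓝 0) :=
    tendsto_zero_of_mul_norm_sq_le hcW (fun k => hW_le _) hres
  -- The S-distance to a KKT point never exceeds its initial value, and it dominates `cS` times the
  -- squared norm.
  have hbdd : ∀ k, z k ∈ Metric.closedBall (u₀, x₀)
      (√(blockNorm (matS Sig Gam) (z 0 - (u₀, x₀)) ^ 2 / cS)) := by
    intro k
    rw [Metric.mem_closedBall, dist_eq_norm]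
    refine Real.le_sqrt_of_sq_le ?_
    rw [le_div_iff₀ hcS, mul_comm]
    exact (hS_le _).trans (hanti (Nat.zero_le k))
  obtain ⟨zs, -, φ, hφ, hzφ⟩ := tendsto_subseq_of_bounded Metric.isBounded_closedBall hbdd
  have hdφ : Tendsto (fun k => z (φ k + 1) - z (φ k)) atTop (𝓝 0) :=
    hdiff.comp hφ.tendsto_atTop
  have hzφ' : Tendsto (fun k => z (φ k + 1)) atTop (𝓝 zs) := by
    have := hdφ.add hzφ
    simpa [Function.comp_def] using this
  have hu : Tendsto (fun k => (z (φ k)).1) atTop (𝓝 zs.1) :=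
    (continuous_fst.tendsto zs).comp hzφ
  have hx : Tendsto (fun k => (z (φ k)).2) atTop (𝓝 zs.2) :=
    (continuous_snd.tendsto zs).comp hzφ
  have hu' : Tendsto (fun k => (z (φ k + 1)).1) atTop (𝓝 zs.1) :=
    (continuous_fst.tendsto zs).comp hzφ'
  have hx' : Tendsto (fun k => (z (φ k + 1)).2) atTop (𝓝 zs.2) :=
    (continuous_snd.tendsto zs).comp hzφ'
  have hact : ∀ {m k : ℕ} (A : Matrix (Fin m) (Fin k) ℝ) {y : ℕ → E k} {y₀ : E k},
      Tendsto y atTop (𝓝 y₀) → Tendsto (fun j => act A (y j)) atTop (𝓝 (act A y₀)) :=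
    fun A _ _ hy => ((continuous_act A).tendsto _).comp hy
  have hact0 : ∀ {m k : ℕ} (A : Matrix (Fin m) (Fin k) ℝ), act A 0 = 0 := fun A => by
    simpa using act_smul A 0 0
  -- The intermediate dual point ū, recovered from consecutive iterates, has the same limit since
  -- the steps vanish.
  have hub : Tendsto (fun k => (z (φ k + 1)).1 -
      act Sig (act L ((z (φ k + 1)).2 - (z (φ k)).2))) atTop (𝓝 zs.1) := by
    simpa [hact0] using hu'.sub (hact Sig (hact L (hx'.sub hx)))
  choose hb ha using fun k => step_spec hg hh hSig hGam (hz (φ k))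
  choose b hb using hb
  choose a ha using ha
  have hs : IsKKT f g h L zs := by
    obtain ⟨b₀, hb₀⟩ := HasSubgradient.of_tendsto hh.conj hb
      (v₀ := act L zs.2)
      (by simpa [hact0] using (hact Sig⁻¹ (hu.sub hub)).add (hact L hx)) hub
    have hgrad : Tendsto (fun k => gradient f (z (φ k)).2) atTop (𝓝 (gradient f zs.2)) :=
      ((continuous_gradient hf_smooth).tendsto _).comp hx
    -- The h-step passes to the limit as Lx ∈ ∂h*(u) and is inverted to u ∈ ∂h(Lx).
    refine ⟨HasSubgradient.of_tendsto hg ha ?_ hx', _, hb₀.of_conj hh⟩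
    convert ((hact Gam⁻¹ (hx.sub hx')).sub hgrad).sub (hact L.transpose hub) using 2
    rw [sub_self, hact0]
    abel
  refine ⟨zs, (hKKT zs).1 hs, ?_⟩
  -- The cluster point is itself KKT, so the distance to it converges along the whole sequence, and
  -- the subsequence identifies the limit as 0.
  obtain ⟨-, ⟨l, hl⟩, -⟩ := hlim zs hs
  have hsub : Tendsto (fun k => blockNorm (matS Sig Gam) (z (φ k) - zs) ^ 2) atTop (𝓝 0) := by
    have hc : Continuous fun w : E r × E n => blockNorm (matS Sig Gam) (w - zs) ^ 2 :=
      ((continuous_blockNorm _).comp (continuous_id.sub continuous_const)).pow 2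
    have := (hc.tendsto zs).comp hzφ
    simpa [blockNorm_matS_sq hSig hGam, Function.comp_def] using this
  have hl0 : l = 0 := tendsto_nhds_unique (hl.comp hφ.tendsto_atTop) hsub
  rw [hl0] at hl
  exact tendsto_sub_nhds_zero_iff.1
    (tendsto_zero_of_mul_norm_sq_le hcS (fun k => hS_le _) hl)
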